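/- Let $L>0$, $m\ge 1$ an integer, $e_n(x)=L^{-1/2}e^{2i\pi nx/L}$, $p_n=\frac{2i\pi n}{L}$, $\langle f,g\rangle=\int_0^L f\bar g$, and $f_n=\langle f,e_n\rangle$ for $f\in L^2(0,L)$. For an integer $s\ge0$ let $H^s_{per}$ be the space of $f\in L^2(0,L)$ with $\|f\|_s^2=\sum_n(1+|p_n|^{2s})|f_n|^2<\infty$. Let $\mathcal E'$ be the space of linear forms on trigonometric polynomials, identified with sequences $(u_n)_{n\in\mathbb Z}$ by $\langle e_n,u\rangle=\overline{u_n}$; it contains $L^2(0,L)$, and $\partial_x u=(p_nu_n)_n$. Let $H^s_{(pw)}$ ($s\ge 1$) be the space of $f\in L^2(0,L)$ for which there are $0=\sigma_0<\sigma_1<\dots<\sigma_{d+1}=L$ with $f\in H^s(\sigma_j,\sigma_{j+1})$ for all $j$. Set $f\star g=\sum_n f_ng_ne_n$. Let $\varphi\in H^m_{(pw)}\cap H^{m-1}_{per}$ be real-valued, with break points $0=\sigma_0<\dots<\sigma_{d+1}=L$, and suppose that for some $c,C>0$ $$\frac{c}{\sqrt{1+|p_n|^{2m}}}\le|\varphi_n|\le\frac{C}{\sqrt{1+|p_n|^{2m}}},\qquad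 n\in\mathbb Z .$$ Let $\mu,\lambda'\in\mathbb R$ with $\lambda:=\lambda'-\mu>0$, and put $\lambda_n=\lambda+p_n$, $K(\lambda)=\frac2L\,\frac{1-e^{-\lambda L}}{1+e^{-\lambda L}}$, and $$\tau^\varphi_n=\frac1{\sqrt L}\Big(\partial^{m-1}\varphi(L)-\partial^{m-1}\varphi(0)+\sum_{j=1}^d e^{-p_n\sigma_j}\big(\partial^{m-1}\varphi(\sigma_j^-)-\partial^{m-1}\varphi(\sigma_j^+)\big)\Big).$$ Let $\tau^\varphi$ be the diagonal operator $\tau^\varphi e_n=\tau^\varphi_ne_n$. Define $F,h\in\mathcal E'$ by $$F_n=-\frac{K(\lambda)}{\overline{\varphi_n}},\qquad h_n=(-1)^m\frac{K(\lambda)}{\tau^\varphi_{-n}}\,p_n^m ,$$ and, for $\alpha\in\tau^\varphi(H^{m+1}_{(pw)})\cap H^m_{per}$ and $\beta=(\tau^\varphi)^{-1}\alpha\in H^{m+1}_{(pw)}$, $$\langle\alpha,F\rangle=\sum_{n}\alpha_n\overline{(F_n-h_n)}+\frac{\sqrt L\,K(\lambda)}2\big(\partial^m\beta(0)+\partial^m\beta(L)\big),$$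 where boundary values are one-sided and $\partial^m\beta$ is taken piecewise. Let $$D_m=\big\{\alpha\in\tau^\varphi(H^{m+1}_{(pw)})\cap H^m_{per}:\ -\partial_x\alpha-\mu\alpha+\langle\alpha,F\rangle\varphi\in H^m_{per}\big\}.$$ Finally, with $\Lambda^\lambda_n(x)=\frac{\sqrt L}{1-e^{-\lambda L}}e^{-\lambda_nx}$ on $(0,L)$ and $k_{n,\lambda}=-\overline{F_{-n}}\,\Lambda^\lambda_n\star\varphi$, let $$T^\lambda\alpha=\sum_{n\in\mathbb Z}\alpha_nk_{-n,\lambda},\qquad \alpha\in H^m_{per}.$$ **Proposition.** One has $k_{n,\lambda}\in H^m_{per}$ for all $n$; for every $\alpha\in H^m_{per}$ the series $T^\lambda\alpha$ converges unconditionally in $H^m_{per}$ and $\sum_n\alpha_n\overline{(F_n-h_n)}$ converges absolutely; $D_m$ is dense in $H^m_{per}$; and for every $\alpha\in D_m$, $$T^\lambda\big(-\partial_x-\mu+\langle\cdot,F\rangle\varphi\big)\alpha=(-\partial_x-\lambda')T^\lambda\alpha\qquad\text{in }H^m_{per}$$ (in particular the right-hand side belongs to $H^m_{per}$). -/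

import Mathlib

open MeasureTheory Set Filter Topology
open scoped ComplexConjugate ContDiff BigOperators

noncomputable section

namespace Backstepping

/-! ### The space `L²(0, L)` and its Fourier basis -/

/-- Lebesgue measure on `(0, L]`. -/
abbrev vol (L : ℝ) : Measure ℝ := volume.restrict (Ioc 0 L)

/-- The space `L²(0, L)` of complex-valued functions. -/
abbrev L2 (L : ℝ) : Type := Lp ℂ 2 (vol L)

theorem memLp_of_continuous (L : ℝ) (f : ℝ → ℂ) (hf : Continuous f) : MemLp f 2 (vol L) := by
  obtain ⟨C, hC⟩ := (isCompact_Icc (a := (0 : ℝ)) (b := L)).exists_bound_of_continuousOn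
    hf.continuousOn
  refine MemLp.of_bound hf.aestronglyMeasurable C ?_
  filter_upwards [ae_restrict_mem measurableSet_Ioc] with x hx
  exact hC x (Ioc_subset_Icc_self hx)

/-- The class in `L²(0, L)` of a continuous function. -/
def ofContinuous (L : ℝ) (f : ℝ → ℂ) (hf : Continuous f) : L2 L :=
  (memLp_of_continuous L f hf).toLp f

/-- The frequency `2 i π n / L`. -/
def freq (L : ℝ) (n : ℤ) : ℂ := 2 * Complex.I * (Real.pi : ℂ) * (n : ℂ) / (L : ℂ)

/-- `e_n(x) = L^{-1/2} exp(2 i π n x / L)`. -/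
def e (L : ℝ) (n : ℤ) (x : ℝ) : ℂ := ((1 / Real.sqrt L : ℝ) : ℂ) * Complex.exp (freq L n * x)

theorem continuous_e (L : ℝ) (n : ℤ) : Continuous (e L n) := by
  unfold e; fun_prop

/-- `e_n` as an element of `L²(0, L)`. -/
def eL2 (L : ℝ) (n : ℤ) : L2 L := ofContinuous L (e L n) (continuous_e L n)

/-- The Fourier coefficient `f_n = ⟨f, e_n⟩ = ∫₀ᴸ f(x) conj(e_n(x)) dx`
(Mathlib's inner product is conjugate-linear in its first argument). -/
def coeff {L : ℝ} (f : L2 L) (n : ℤ) : ℂ := inner ℂ (eL2 L n) f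

theorem coeff_eq_integral {L : ℝ} (f : L2 L) (n : ℤ) :
    coeff f n = ∫ x in Ioc 0 L, f x * conj (e L n x) := by
  rw [coeff, L2.inner_def]
  refine integral_congr_ae ?_
  filter_upwards [(memLp_of_continuous L (e L n) (continuous_e L n)).coeFn_toLp] with x hx
  simp only [eL2, ofContinuous, hx, RCLike.inner_apply]

theorem coeff_add {L : ℝ} (f g : L2 L) (n : ℤ) : coeff (f + g) n = coeff f n + coeff g n :=
  inner_add_right _ _ _

theorem coeff_smul {L : ℝ} (c : ℂ) (f : L2 L) (n : ℤ) : coeff (c • f) n = c * coeff f n :=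
  inner_smul_right _ _ _

/-- A function of `L²(0, L)` is determined by its Fourier coefficients. -/
theorem eq_zero_of_coeff {L : ℝ} (f : L2 L) (h : ∀ n, coeff f n = 0) : f = 0 := by
  rcases le_or_gt L 0 with hL | hL
  · refine (Lp.eq_zero_iff_ae_eq_zero).2 ?_
    have : vol L = 0 := by rw [vol, Ioc_eq_empty (not_lt.2 hL), Measure.restrict_empty]
    simp [Filter.EventuallyEq, this]
  · have hmem : MemLp (f : ℝ → ℂ) 2 (vol L) := Lp.memLp f
    have key : ∀ n, fourierCoeffOn hL (f : ℝ → ℂ) n = 0 := by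
      intro n
      have h1 := h n
      rw [coeff_eq_integral] at h1
      rw [fourierCoeffOn_eq_integral, intervalIntegral.integral_of_le hL.le]
      have h2 : ∀ x : ℝ, fourier (-n) (x : AddCircle (L - 0)) • f x
          = ((Real.sqrt L : ℝ) : ℂ) * (f x * conj (e L n x)) := by
        intro x
        have hs : ((Real.sqrt L : ℝ) : ℂ) ≠ 0 := by
          exact_mod_cast (Real.sqrt_pos.2 hL).ne'
        have hc : conj (freq L n * (x : ℂ))
            = 2 * (Real.pi : ℂ) * Complex.I * ((-n : ℤ) : ℂ) * x / ((L - 0 : ℝ) : ℂ) := by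
          simp [freq, Complex.conj_ofNat]; ring
        rw [fourier_coe_apply, e, map_mul, Complex.conj_ofReal, ← Complex.exp_conj, hc, smul_eq_mul]
        push_cast
        field_simp
      simp_rw [h2]
      rw [integral_const_mul, h1, mul_zero, smul_zero]
    have hs := hasSum_sq_fourierCoeffOn hL hmem
    simp only [key, norm_zero, ne_eq, OfNat.ofNat_ne_zero, not_false_eq_true, zero_pow] at hs
    have h0 : (L - 0)⁻¹ • ∫ x in (0 : ℝ)..L, ‖f x‖ ^ 2 = 0 := hs.unique hasSum_zero
    have h3 : ∫ x in Ioc 0 L, ‖f x‖ ^ 2 = 0 := by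
      rw [intervalIntegral.integral_of_le hL.le, smul_eq_mul] at h0
      rcases mul_eq_zero.1 h0 with h4 | h4
      · rw [sub_zero, inv_eq_zero] at h4; exact absurd h4 hL.ne'
      · exact h4
    have h5 := (integral_eq_zero_iff_of_nonneg (fun x => by positivity)
      ((memLp_two_iff_integrable_sq_norm hmem.1).1 hmem)).1 h3
    refine (Lp.eq_zero_iff_ae_eq_zero).2 ?_
    filter_upwards [h5] with x hx
    simpa using hx

/-! ### Periodic Sobolev spaces -/

/-- The weight `1 + |2 i π n / L|^{2 m}`. -/
def weight (L : ℝ) (m : ℕ) (n : ℤ) : ℝ := 1 + ‖freq L n‖ ^ (2 * m)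

theorem weight_pos (L : ℝ) (m : ℕ) (n : ℤ) : 0 < weight L m n := by
  unfold weight; positivity

/-- The Fourier coefficients of `f`, multiplied by the square root of the weight. -/
def weightedCoeff {L : ℝ} (m : ℕ) (f : L2 L) (n : ℤ) : ℂ :=
  ((Real.sqrt (weight L m n) : ℝ) : ℂ) * coeff f n

theorem norm_weightedCoeff_sq {L : ℝ} (m : ℕ) (f : L2 L) (n : ℤ) :
    ‖weightedCoeff m f n‖ ^ 2 = weight L m n * ‖coeff f n‖ ^ 2 := by
  rw [weightedCoeff, norm_mul, mul_pow, Complex.norm_real, Real.norm_eq_abs, sq_abs,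
    Real.sq_sqrt (weight_pos L m n).le]

theorem memlp_weightedCoeff_iff {L : ℝ} (m : ℕ) (f : L2 L) :
    Memℓp (weightedCoeff m f) 2 ↔ Summable (fun n : ℤ => weight L m n * ‖coeff f n‖ ^ 2) := by
  rw [memℓp_gen_iff (by norm_num)]
  simp only [ENNReal.toReal_ofNat, Real.rpow_ofNat, norm_weightedCoeff_sq]

/-- The space `H^m_per`: the `f ∈ L²(0, L)` with `∑ (1 + |2 i π n / L|^{2 m}) |f_n|² < ∞`. -/
def sobolevPer (L : ℝ) (m : ℕ) : Submodule ℂ (L2 L) where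
  carrier := {f | Summable (fun n : ℤ => weight L m n * ‖coeff f n‖ ^ 2)}
  zero_mem' := by simp [coeff, summable_zero]
  add_mem' := by
    intro f g hf hg
    rw [mem_ofPred_eq, ← memlp_weightedCoeff_iff] at *
    convert hf.add hg using 1
    ext n; simp [weightedCoeff, coeff_add, mul_add]
  smul_mem' := by
    intro c f hf
    rw [mem_ofPred_eq, ← memlp_weightedCoeff_iff] at *
    convert hf.const_smul c using 1
    ext n; simp [weightedCoeff, coeff_smul]; ring

/-- The type of elements of `H^m_per`; it carries its own norm, not the norm of `L²(0, L)`. -/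
def HPer (L : ℝ) (m : ℕ) : Type := ↥(sobolevPer L m)

instance (L : ℝ) (m : ℕ) : AddCommGroup (HPer L m) :=
  inferInstanceAs (AddCommGroup ↥(sobolevPer L m))

instance (L : ℝ) (m : ℕ) : Module ℂ (HPer L m) :=
  inferInstanceAs (Module ℂ ↥(sobolevPer L m))

/-- The inclusion of `H^m_per` in `L²(0, L)`. -/
def HPer.toL2 {L : ℝ} {m : ℕ} : HPer L m →ₗ[ℂ] L2 L := (sobolevPer L m).subtype

/-- The linear map from `H^m_per` to `ℓ²` that defines the norm of `H^m_per`. -/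
def HPer.toSeq (L : ℝ) (m : ℕ) : HPer L m →ₗ[ℂ] lp (fun _ : ℤ => ℂ) 2 where
  toFun f := ⟨weightedCoeff m f.toL2, (memlp_weightedCoeff_iff m f.toL2).2 f.property⟩
  map_add' f g := by
    ext n
    change weightedCoeff m (HPer.toL2 (f + g)) n
      = weightedCoeff m f.toL2 n + weightedCoeff m g.toL2 n
    simp [weightedCoeff, coeff_add, mul_add]
  map_smul' c f := by
    ext n
    change weightedCoeff m (HPer.toL2 (c • f)) n = c * weightedCoeff m f.toL2 n
    simp [weightedCoeff, coeff_smul]; ring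

theorem HPer.toSeq_injective (L : ℝ) (m : ℕ) : Function.Injective (HPer.toSeq L m) := by
  rw [injective_iff_map_eq_zero]
  intro f hf
  refine Subtype.ext (eq_zero_of_coeff f.toL2 fun n => ?_)
  have h1 : weightedCoeff m f.toL2 n = 0 := congrArg (fun u : lp (fun _ : ℤ => ℂ) 2 => u n) hf
  rcases mul_eq_zero.1 h1 with h2 | h2
  · exact absurd (Complex.ofReal_eq_zero.1 h2) (Real.sqrt_pos.2 (weight_pos L m n)).ne'
  · exact h2

instance (L : ℝ) (m : ℕ) : NormedAddCommGroup (HPer L m) :=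
  NormedAddCommGroup.induced (HPer L m) (lp (fun _ : ℤ => ℂ) 2) (HPer.toSeq L m)
    (HPer.toSeq_injective L m)

instance (L : ℝ) (m : ℕ) : NormedSpace ℂ (HPer L m) :=
  NormedSpace.induced ℂ (HPer L m) (lp (fun _ : ℤ => ℂ) 2) (HPer.toSeq L m)

/-- The norm of `H^m_per` is `‖f‖_m² = ∑ (1 + |2 i π n / L|^{2 m}) |f_n|²`. -/
theorem HPer.norm_sq {L : ℝ} {m : ℕ} (f : HPer L m) :
    ‖f‖ ^ 2 = ∑' n : ℤ, weight L m n * ‖coeff f.toL2 n‖ ^ 2 := by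
  have h1 : ‖f‖ = ‖HPer.toSeq L m f‖ := rfl
  have h2 := lp.norm_rpow_eq_tsum (p := 2) (by norm_num) (HPer.toSeq L m f)
  simp only [ENNReal.toReal_ofNat, Real.rpow_ofNat] at h2
  rw [h1, h2]
  exact tsum_congr fun n => norm_weightedCoeff_sq m f.toL2 n

open Classical in
/-- An `L²` function regarded as an element of `H^m_per` (and `0` if it is not in `H^m_per`). -/
def toHPer {L : ℝ} (m : ℕ) (f : L2 L) : HPer L m :=
  if h : f ∈ sobolevPer L m then (⟨f, h⟩ : ↥(sobolevPer L m)) else 0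

/-! ### The space `𝓔'` of linear forms on trigonometric polynomials -/

/-- `𝓔'`: a linear form `u` on the span of the `e_n` is given by the arbitrary sequence `(u_n)` of
its coefficients, `⟨e_n, u⟩ = conj u_n`. -/
abbrev PerDual : Type := ℤ → ℂ

/-- An `L²` function as an element of `𝓔'`. -/
def toDual {L : ℝ} (f : L2 L) : PerDual := coeff f

/-- An element of `H^m_per` as an element of `𝓔'`. -/
def HPer.toDual {L : ℝ} {m : ℕ} (f : HPer L m) : PerDual := Backstepping.toDual f.toL2

/-- The derivative in `𝓔'`: `u' = (2 i π n / L) u_n`. -/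
def derivDual (L : ℝ) (u : PerDual) : PerDual := fun n => freq L n * u n

/-! ### Sobolev functions on an interval, one-sided values, piecewise Sobolev functions -/

/-- `g` is the `k`-th weak derivative of `f` on the interval `(a, b)`. -/
def HasWeakDeriv (a b : ℝ) (k : ℕ) (f g : ℝ → ℂ) : Prop :=
  IntegrableOn f (Ioo a b) ∧ IntegrableOn g (Ioo a b) ∧
    ∀ ψ : ℝ → ℝ, ContDiff ℝ ∞ ψ → HasCompactSupport ψ → tsupport ψ ⊆ Ioo a b →
      ∫ x in Ioo a b, iteratedDeriv k ψ x • f x = (-1) ^ k * ∫ x in Ioo a b, ψ x • g x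

/-- `f ∈ H^m(a, b)`: the weak derivatives of `f` up to order `m` are in `L²(a, b)`. -/
def MemSobolev (a b : ℝ) (m : ℕ) (f : ℝ → ℂ) : Prop :=
  ∀ k ≤ m, ∃ g : ℝ → ℂ, MemLp g 2 (volume.restrict (Ioo a b)) ∧ HasWeakDeriv a b k f g

/-- `0 = σ_0 < σ_1 < ... < σ_d < σ_{d+1} = L`, and `f` is `H^m` on each `(σ_j, σ_{j+1})`. -/
def IsPiecewiseSobolev {L : ℝ} (m : ℕ) (f : L2 L) (d : ℕ) (σ : Fin (d + 2) → ℝ) : Prop :=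
  StrictMono σ ∧ σ 0 = 0 ∧ σ (Fin.last (d + 1)) = L ∧
    ∀ j : Fin (d + 1), MemSobolev (σ j.castSucc) (σ j.succ) m f

/-- `f ∈ H^m_(pw)`. -/
def MemPiecewiseSobolev {L : ℝ} (m : ℕ) (f : L2 L) : Prop :=
  ∃ (d : ℕ) (σ : Fin (d + 2) → ℝ), IsPiecewiseSobolev m f d σ

/-- `∂^k f (x⁺) = c`: on some `(x, b)` the `k`-th weak derivative of `f` has a representative that
is continuous on `[x, b]` and takes the value `c` at `x`. -/
def HasRightValue (k : ℕ) (f : ℝ → ℂ) (x : ℝ) (c : ℂ) : Prop :=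
  ∃ b > x, ∃ g : ℝ → ℂ, ContinuousOn g (Icc x b) ∧ HasWeakDeriv x b k f g ∧ g x = c

/-- `∂^k f (x⁻) = c`: on some `(a, x)` the `k`-th weak derivative of `f` has a representative that
is continuous on `[a, x]` and takes the value `c` at `x`. -/
def HasLeftValue (k : ℕ) (f : ℝ → ℂ) (x : ℝ) (c : ℂ) : Prop :=
  ∃ a < x, ∃ g : ℝ → ℂ, ContinuousOn g (Icc a x) ∧ HasWeakDeriv a x k f g ∧ g x = c

open Classical in
/-- The one-sided value `∂^k f (x⁺)`. -/
def rightValue (k : ℕ) (f : ℝ → ℂ) (x : ℝ) : ℂ :=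
  if h : ∃ c, HasRightValue k f x c then h.choose else 0

open Classical in
/-- The one-sided value `∂^k f (x⁻)`. -/
def leftValue (k : ℕ) (f : ℝ → ℂ) (x : ℝ) : ℂ :=
  if h : ∃ c, HasLeftValue k f x c then h.choose else 0

/-! ### The operator `τ^φ`, the feedback law, and the domain -/

/-- The numbers `τ^φ_n`; the interior points `σ_1, ..., σ_d` are indexed by `Fin d`. -/
def tau {L : ℝ} (m : ℕ) (φ : L2 L) (d : ℕ) (σ : Fin (d + 2) → ℝ) (n : ℤ) : ℂ :=
  ((1 / Real.sqrt L : ℝ) : ℂ) *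
    (leftValue (m - 1) φ L - rightValue (m - 1) φ 0 +
      ∑ j : Fin d, Complex.exp (-(freq L n * (σ j.succ.castSucc : ℂ))) *
        (leftValue (m - 1) φ (σ j.succ.castSucc) - rightValue (m - 1) φ (σ j.succ.castSucc)))

/-- `α = τ^φ β`, where `τ^φ` is the diagonal operator with eigenvalues `τ^φ_n`. -/
def IsTauImage {L : ℝ} (m : ℕ) (φ : L2 L) (d : ℕ) (σ : Fin (d + 2) → ℝ) (β α : L2 L) : Prop :=
  ∀ n : ℤ, coeff α n = tau m φ d σ n * coeff β n

/-- `α ∈ τ^φ(H^{m+1}_(pw))`. -/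
def MemTauRange {L : ℝ} (m : ℕ) (φ : L2 L) (d : ℕ) (σ : Fin (d + 2) → ℝ) (α : L2 L) : Prop :=
  ∃ β : L2 L, MemPiecewiseSobolev (m + 1) β ∧ IsTauImage m φ d σ β α

open Classical in
/-- `(τ^φ)⁻¹ α ∈ H^{m+1}_(pw)` for `α ∈ τ^φ(H^{m+1}_(pw))`. -/
def tauInv {L : ℝ} (m : ℕ) (φ : L2 L) (d : ℕ) (σ : Fin (d + 2) → ℝ) (α : L2 L) : L2 L :=
  if h : MemTauRange m φ d σ α then h.choose else 0

/-- `K(λ) = (2 / L) (1 - e^{-λ L}) / (1 + e^{-λ L})`. -/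
def K (L lam : ℝ) : ℝ := 2 / L * ((1 - Real.exp (-(lam * L))) / (1 + Real.exp (-(lam * L))))

/-- The feedback law `F ∈ 𝓔'`, `F_n = - K(λ) / conj φ_n`. -/
def F {L : ℝ} (lam : ℝ) (φ : L2 L) : PerDual := fun n => -(K L lam : ℂ) / conj (coeff φ n)

/-- The singular part `h ∈ 𝓔'` of `F`, `h_n = (-1)^m K(λ) / τ^φ_{-n} (2 i π n / L)^m`. -/
def singularPart {L : ℝ} (m : ℕ) (lam : ℝ) (φ : L2 L) (d : ℕ) (σ : Fin (d + 2) → ℝ) : PerDual :=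
  fun n => (-1) ^ m * ((K L lam : ℂ) / tau m φ d σ (-n)) * freq L n ^ m

/-- The regular part `F - h` of `F`. -/
def regularPart {L : ℝ} (m : ℕ) (lam : ℝ) (φ : L2 L) (d : ℕ) (σ : Fin (d + 2) → ℝ) : PerDual :=
  F lam φ - singularPart m lam φ d σ

/-- `⟨α, F⟩ = ⟨α, F - h⟩ + ⟨α, h⟩`, for `α ∈ τ^φ(H^{m+1}_(pw)) ∩ H^m_per`, where
`⟨α, h⟩ = √L K(λ) / 2 (∂^m((τ^φ)⁻¹ α)(0) + ∂^m((τ^φ)⁻¹ α)(L))`. -/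
def pairing {L : ℝ} (m : ℕ) (lam : ℝ) (φ : L2 L) (d : ℕ) (σ : Fin (d + 2) → ℝ) (α : L2 L) : ℂ :=
  (∑' n : ℤ, coeff α n * conj (regularPart m lam φ d σ n)) +
    ((Real.sqrt L * K L lam / 2 : ℝ) : ℂ) *
      (rightValue m (tauInv m φ d σ α) 0 + leftValue m (tauInv m φ d σ α) L)

/-- `-α_x - μ α + ⟨α, F⟩ φ`, as an element of `𝓔'`. -/
def closedLoop {L : ℝ} (m : ℕ) (lam μ : ℝ) (φ : L2 L) (d : ℕ) (σ : Fin (d + 2) → ℝ)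
    (α : HPer L m) : PerDual :=
  -derivDual L α.toDual - (μ : ℂ) • α.toDual + pairing m lam φ d σ α.toL2 • toDual φ

/-- The domain `D_m`: the `α ∈ τ^φ(H^{m+1}_(pw)) ∩ H^m_per` for which
`-α_x - μ α + ⟨α, F⟩ φ` is in `H^m_per`. -/
def domain {L : ℝ} (m : ℕ) (lam μ : ℝ) (φ : L2 L) (d : ℕ) (σ : Fin (d + 2) → ℝ) :
    Set (HPer L m) :=
  {α | MemTauRange m φ d σ α.toL2 ∧ ∃ g : HPer L m, g.toDual = closedLoop m lam μ φ d σ α}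

/-! ### The backstepping transformation -/

/-- `Λ^λ_n(x) = √L / (1 - e^{-λ L}) e^{-λ_n x}` on `(0, L)`, where `λ_n = λ + 2 i π n / L`. -/
def Lam (L lam : ℝ) (n : ℤ) : L2 L :=
  ofContinuous L
    (fun x : ℝ => ((Real.sqrt L / (1 - Real.exp (-(lam * L))) : ℝ) : ℂ) *
      Complex.exp (-(((lam : ℂ) + freq L n) * x)))
    (by fun_prop)

/-- `f ⋆ g = ∑ f_n g_n e_n`. -/
def conv {L : ℝ} (f g : L2 L) : L2 L := ∑' n : ℤ, (coeff f n * coeff g n) • eL2 L n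

/-- `k_{n,λ} = - conj(F_{-n}) Λ^λ_n ⋆ φ`. -/
def kernel {L : ℝ} (lam : ℝ) (φ : L2 L) (n : ℤ) : L2 L :=
  -(conj (F lam φ (-n))) • conv (Lam L lam n) φ

/-- `T^λ α = ∑ α_n k_{-n,λ}`, a series in `H^m_per`. -/
def T {L : ℝ} (m : ℕ) (lam : ℝ) (φ : L2 L) (α : HPer L m) : HPer L m :=
  ∑' n : ℤ, coeff α.toL2 n • toHPer m (kernel lam φ (-n))

end Backstepping

end

namespace Backstepping

/-! ### Fourier series in `L²(0, L)` -/

/-! On Fourier coefficients the kernels are explicit: the `p`-th coefficient of `kernel lam φ (-n)`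
is `(K / φ_n) * φ_p / (λ + p_{p-n})`. Hence `T` factors as division by `φ_n` (times `K`),
multiplication by `L e^{-λx} / (1 - e^{-λL})`, and the Fourier multiplier `φ_p`. The two-sided bound
on `φ_n` makes the outer factors bounded `H^m_per → L²` and `L² → H^m_per`, so unconditional
convergence is inherited from the expansion of an `L²` function (`hasSum_T`).

The operator equality rests on `(p_p + λ') - (p_n + μ) = λ + p_{p-n}`, which cancels the
denominator. Formally, the `p`-th coefficient of `T(-∂ - μ)α + (∂ + λ')Tα` is `φ_p ∑ K α_n / φ_n =
-φ_p ⟨α, F⟩`, and that of `Tφ` is `φ_p ∑ K / (λ + p_{p-n}) = φ_p`; the two contributions of the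
feedback cancel. These series need not converge unconditionally, so all sums are taken over `|n| ≤
N` and then `N → ∞` (`coeff_T_closedLoop`). The limits come from one fact: the symmetric partial
sums of the Fourier series at the end point tend to the mean of the two end values
(`tendsto_sum_coeff`). Applied to `Λ^λ_p` it gives `1`, which is what fixes `K`
(`tendsto_sum_inv_lam`); applied to `∂^m β` it gives the boundary term of `pairing`
(`tendsto_pairing`).

For the splitting of `F`, integration by parts on the pieces gives `p_n^m φ_n = -τ_n + ψ_n` with `ψ
∈ ℓ²`. The lower bound on `φ_n` bounds `τ_n` below for large `n`, and since `τ` is a finite sum of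
exponentials it is recurrent, so the bound holds for every `n` (`tau_bounded_below`). Then `F - h`
is `√weight` times an `ℓ²` sequence and pairs absolutely with `H^m_per`.

Density holds because trigonometric polynomials annihilated by `F` lie in the domain, and `F` is
unbounded on `H^m_per`: a prescribed value of `F` can be spread over `N` frequencies at a cost of
order `N^{-1/2}` in norm (`dense_domain`). -/

theorem freq_zero (L : ℝ) : freq L 0 = 0 := by simp [freq]

theorem freq_add (L : ℝ) (k n : ℤ) : freq L (k + n) = freq L k + freq L n := by
  simp [freq]; ring

theorem freq_neg (L : ℝ) (n : ℤ) : freq L (-n) = -freq L n := by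
  simp [freq]; ring

theorem freq_sub (L : ℝ) (k n : ℤ) : freq L (k - n) = freq L k - freq L n := by
  rw [sub_eq_add_neg, freq_add, freq_neg, sub_eq_add_neg]

theorem conj_freq (L : ℝ) (n : ℤ) : conj (freq L n) = -freq L n := by
  simp [freq, Complex.conj_ofNat]; ring

theorem freq_re (L : ℝ) (n : ℤ) : (freq L n).re = 0 := by
  have h := congrArg Complex.re (conj_freq L n)
  rw [Complex.conj_re, Complex.neg_re] at h
  linarith

theorem norm_freq {L : ℝ} (hL : 0 < L) (n : ℤ) : ‖freq L n‖ = 2 * Real.pi * |(n : ℝ)| / L := by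
  simp [freq, abs_of_pos hL, abs_of_pos Real.pi_pos]

theorem freq_ne_zero {L : ℝ} (hL : 0 < L) {n : ℤ} (hn : n ≠ 0) : freq L n ≠ 0 := by
  rw [← norm_ne_zero_iff, norm_freq hL]
  have := Real.pi_pos
  positivity

theorem exp_freq_mul_period {L : ℝ} (hL : 0 < L) (n : ℤ) : Complex.exp (freq L n * L) = 1 := by
  have h : freq L n * L = n * (2 * Real.pi * Complex.I) := by
    have : (L : ℂ) ≠ 0 := by exact_mod_cast hL.ne'
    rw [freq]; field_simp
  rw [h, Complex.exp_int_mul_two_pi_mul_I]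

theorem conj_e (L : ℝ) (n : ℤ) (x : ℝ) : conj (e L n x) = e L (-n) x := by
  rw [e, e, map_mul, Complex.conj_ofReal, ← Complex.exp_conj, map_mul, conj_freq, freq_neg,
    Complex.conj_ofReal]

theorem norm_e_le {L : ℝ} (n : ℤ) (x : ℝ) : ‖e L n x‖ ≤ 1 / Real.sqrt L := by
  rw [e, norm_mul, Complex.norm_exp, Complex.re_mul_ofReal, freq_re, zero_mul, Real.exp_zero,
    mul_one, Complex.norm_real, Real.norm_of_nonneg (by positivity)]

theorem coeFn_ofContinuous (L : ℝ) (f : ℝ → ℂ) (hf : Continuous f) :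
    ofContinuous L f hf =ᵐ[vol L] f :=
  (memLp_of_continuous L f hf).coeFn_toLp

theorem coeff_congr {L : ℝ} {f : L2 L} {g : ℝ → ℂ} (h : f =ᵐ[vol L] g) (n : ℤ) :
    coeff f n = ∫ x in Ioc 0 L, g x * conj (e L n x) := by
  rw [coeff_eq_integral]
  refine integral_congr_ae ?_
  filter_upwards [h] with x hx
  rw [hx]

theorem integral_exp_Ioc {L : ℝ} (hL : 0 < L) {z : ℂ} (hz : z ≠ 0) :
    ∫ x in Ioc 0 L, Complex.exp (z * (x : ℂ)) = (Complex.exp (z * L) - 1) / z := by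
  rw [← intervalIntegral.integral_of_le hL.le, integral_exp_mul_complex hz]
  simp

theorem one_div_sqrt_sq {L : ℝ} (hL : 0 < L) :
    ((1 / Real.sqrt L : ℝ) : ℂ) * ((1 / Real.sqrt L : ℝ) : ℂ) = 1 / L := by
  rw [← Complex.ofReal_mul, div_mul_div_comm, Real.mul_self_sqrt hL.le]
  simp

theorem coeff_eL2 {L : ℝ} (hL : 0 < L) (k n : ℤ) :
    coeff (eL2 L k) n = if n = k then 1 else 0 := by
  have hL' : (L : ℂ) ≠ 0 := by exact_mod_cast hL.ne'
  rw [eL2, coeff_congr (coeFn_ofContinuous L _ (continuous_e L k))]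
  have h1 : ∀ x : ℝ, e L k x * conj (e L n x) = 1 / L * Complex.exp (freq L (k - n) * x) := by
    intro x
    rw [conj_e, e, e, mul_mul_mul_comm, one_div_sqrt_sq hL, ← Complex.exp_add, freq_sub, freq_neg]
    ring_nf
  simp_rw [h1]
  rw [integral_const_mul]
  split_ifs with h
  · subst h
    simp [freq_zero, hL.le, hL']
  · rw [integral_exp_Ioc hL (freq_ne_zero hL (sub_ne_zero.2 (Ne.symm h))), exp_freq_mul_period hL]
    simp

theorem orthonormal_eL2 {L : ℝ} (hL : 0 < L) : Orthonormal ℂ (eL2 L) := by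
  rw [orthonormal_iff_ite]
  intro i j
  exact coeff_eL2 hL j i

/-- The Hilbert basis `(e_n)` of `L²(0, L)`. -/
noncomputable def basis {L : ℝ} (hL : 0 < L) : HilbertBasis ℤ ℂ (L2 L) :=
  HilbertBasis.mkOfOrthogonalEqBot (orthonormal_eL2 hL) (by
    rw [Submodule.eq_bot_iff]
    intro f hf
    refine eq_zero_of_coeff f fun n => ?_
    exact (Submodule.mem_orthogonal _ _).1 hf _ (Submodule.subset_span ⟨n, rfl⟩))

theorem basis_apply {L : ℝ} (hL : 0 < L) (n : ℤ) : basis hL n = eL2 L n := by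
  rw [basis, HilbertBasis.coe_mkOfOrthogonalEqBot]

theorem basis_repr {L : ℝ} (hL : 0 < L) (f : L2 L) (n : ℤ) : (basis hL).repr f n = coeff f n := by
  rw [HilbertBasis.repr_apply_apply, basis_apply, coeff]

theorem memlp_coeff {L : ℝ} (hL : 0 < L) (f : L2 L) : Memℓp (coeff f) 2 := by
  have h := lp.memℓp ((basis hL).repr f)
  rwa [show ⇑((basis hL).repr f) = coeff f from funext (basis_repr hL f)] at h

theorem memlp_two_iff {a : ℤ → ℂ} : Memℓp a 2 ↔ Summable fun n => ‖a n‖ ^ 2 := by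
  rw [memℓp_gen_iff (by norm_num)]
  simp only [ENNReal.toReal_ofNat, Real.rpow_ofNat]

theorem coeff_injective {L : ℝ} {f g : L2 L} (h : ∀ n, coeff f n = coeff g n) : f = g := by
  rw [← sub_eq_zero]
  refine eq_zero_of_coeff _ fun n => ?_
  rw [coeff, inner_sub_right]
  exact sub_eq_zero.2 (h n)

theorem hasSum_coeff {L : ℝ} (hL : 0 < L) (f : L2 L) :
    HasSum (fun n => coeff f n • eL2 L n) f := by
  simpa only [basis_repr, basis_apply] using (basis hL).hasSum_repr f

theorem exists_coeff_eq {L : ℝ} (hL : 0 < L) {a : ℤ → ℂ} (ha : Memℓp a 2) :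
    ∃ f : L2 L, ∀ n, coeff f n = a n :=
  ⟨(basis hL).repr.symm ⟨a, ha⟩, fun n => by
    rw [← basis_repr hL, LinearIsometryEquiv.apply_symm_apply]⟩

theorem hasSum_norm_sq {L : ℝ} (hL : 0 < L) (f : L2 L) :
    HasSum (fun n => ‖coeff f n‖ ^ 2) (‖f‖ ^ 2) := by
  have h := lp.hasSum_norm (p := 2) (by norm_num) ((basis hL).repr f)
  simpa only [ENNReal.toReal_ofNat, Real.rpow_ofNat, LinearIsometryEquiv.norm_map,
    basis_repr] using h

theorem norm_coeff_le {L : ℝ} (hL : 0 < L) (f : L2 L) (n : ℤ) : ‖coeff f n‖ ≤ ‖f‖ := by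
  have h := (hasSum_norm_sq hL f).summable.le_tsum n (fun _ _ => by positivity)
  rw [(hasSum_norm_sq hL f).tsum_eq] at h
  exact (sq_le_sq₀ (norm_nonneg _) (norm_nonneg _)).1 h

theorem tendsto_coeff_cofinite {L : ℝ} (hL : 0 < L) (f : L2 L) :
    Tendsto (coeff f) cofinite (𝓝 0) := by
  have h := (hasSum_norm_sq hL f).summable.tendsto_cofinite_zero
  have h2 := h.sqrt
  simp only [Real.sqrt_sq (norm_nonneg _), Real.sqrt_zero] at h2
  exact tendsto_zero_iff_norm_tendsto_zero.2 h2

/-! ### Operators on the periodic Sobolev spaces -/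

theorem one_le_weight (L : ℝ) (m : ℕ) (n : ℤ) : 1 ≤ weight L m n := by
  rw [weight]; linarith [pow_nonneg (norm_nonneg (freq L n)) (2 * m)]

theorem weight_neg (L : ℝ) (m : ℕ) (n : ℤ) : weight L m (-n) = weight L m n := by
  rw [weight, weight, freq_neg, norm_neg]

theorem mem_sobolevPer_iff {L : ℝ} {m : ℕ} {f : L2 L} :
    f ∈ sobolevPer L m ↔ Summable fun n : ℤ => weight L m n * ‖coeff f n‖ ^ 2 := Iff.rfl

/-- An element of `H^m_per` given by an `L²` function in that space. -/
def HPer.mk {L : ℝ} {m : ℕ} (f : L2 L) (hf : f ∈ sobolevPer L m) : HPer L m :=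
  (⟨f, hf⟩ : ↥(sobolevPer L m))

theorem HPer.toL2_mk {L : ℝ} {m : ℕ} (f : L2 L) (hf : f ∈ sobolevPer L m) :
    (HPer.mk f hf).toL2 = f := rfl

theorem HPer.toL2_mem {L : ℝ} {m : ℕ} (f : HPer L m) : f.toL2 ∈ sobolevPer L m := f.property

theorem HPer.summable {L : ℝ} {m : ℕ} (f : HPer L m) :
    Summable fun n : ℤ => weight L m n * ‖coeff f.toL2 n‖ ^ 2 := f.property

theorem HPer.ext_coeff {L : ℝ} {m : ℕ} {f g : HPer L m}
    (h : ∀ n, coeff f.toL2 n = coeff g.toL2 n) : f = g :=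
  Subtype.ext (coeff_injective h)

theorem toHPer_toL2 {L : ℝ} {m : ℕ} {f : L2 L} (hf : f ∈ sobolevPer L m) :
    (toHPer m f).toL2 = f := by
  have h : toHPer m f = HPer.mk f hf := dif_pos hf
  rw [h, HPer.toL2_mk]

theorem HPer.norm_toL2_le {L : ℝ} (hL : 0 < L) {m : ℕ} (f : HPer L m) : ‖f.toL2‖ ≤ ‖f‖ := by
  rw [← sq_le_sq₀ (norm_nonneg _) (norm_nonneg _), HPer.norm_sq,
    ← (hasSum_norm_sq hL f.toL2).tsum_eq]
  refine (hasSum_norm_sq hL f.toL2).summable.tsum_le_tsum (fun n => ?_) f.summable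
  exact le_mul_of_one_le_left (by positivity) (one_le_weight L m n)

/-- The Fourier coefficient, as a continuous linear form on `H^m_per`. -/
noncomputable def HPer.coeffL {L : ℝ} (hL : 0 < L) (m : ℕ) (n : ℤ) : HPer L m →L[ℂ] ℂ :=
  LinearMap.mkContinuous
    { toFun := fun f => coeff f.toL2 n
      map_add' := fun f g => by rw [map_add, coeff_add]
      map_smul' := fun c f => by rw [map_smul, coeff_smul]; rfl }
    1 (fun f => by
      rw [one_mul]
      exact (norm_coeff_le hL _ n).trans (HPer.norm_toL2_le hL f))

theorem HPer.coeffL_apply {L : ℝ} (hL : 0 < L) (m : ℕ) (n : ℤ) (f : HPer L m) :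
    HPer.coeffL hL m n f = coeff f.toL2 n := rfl

/-- The Fourier multiplier with symbol `O(weight^{-1/2})` maps `L²` continuously to `H^m_per`. -/
theorem exists_multiplier {L : ℝ} (hL : 0 < L) (m : ℕ) (a : ℤ → ℂ) (C : ℝ)
    (ha : ∀ n, ‖a n‖ ≤ C / Real.sqrt (weight L m n)) :
    ∃ D : L2 L →L[ℂ] HPer L m, ∀ f n, coeff (D f).toL2 n = a n * coeff f n := by
  have hC : 0 ≤ C := by
    have h := (norm_nonneg _).trans (ha 0)
    have h2 := Real.sqrt_pos.2 (weight_pos L m 0)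
    by_contra hneg
    exact absurd h (not_le.2 (div_neg_of_neg_of_pos (not_le.1 hneg) h2))
  have hw : ∀ (f : L2 L) (n : ℤ),
      weight L m n * ‖a n * coeff f n‖ ^ 2 ≤ C ^ 2 * ‖coeff f n‖ ^ 2 := by
    intro f n
    have h1 : weight L m n * ‖a n‖ ^ 2 ≤ C ^ 2 := by
      have h2 := pow_le_pow_left₀ (norm_nonneg _) (ha n) 2
      rw [div_pow, Real.sq_sqrt (weight_pos L m n).le, le_div_iff₀ (weight_pos L m n)] at h2
      linarith
    rw [norm_mul, mul_pow, ← mul_assoc]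
    gcongr
  have hs : ∀ f : L2 L, Summable fun n => weight L m n * ‖a n * coeff f n‖ ^ 2 := fun f =>
    Summable.of_nonneg_of_le (fun n => mul_nonneg (weight_pos L m n).le (by positivity)) (hw f)
      ((hasSum_norm_sq hL f).summable.mul_left _)
  have hex : ∀ f : L2 L, ∃ g : HPer L m, ∀ n, coeff g.toL2 n = a n * coeff f n := by
    intro f
    have hmem : Memℓp (fun n => a n * coeff f n) 2 := by
      refine memlp_two_iff.2 (Summable.of_nonneg_of_le (fun n => by positivity) (fun n => ?_)
        (hs f))
      exact le_mul_of_one_le_left (by positivity) (one_le_weight L m n)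
    obtain ⟨g, hg⟩ := exists_coeff_eq hL hmem
    exact ⟨HPer.mk g (by simpa only [mem_sobolevPer_iff, hg] using hs f), hg⟩
  choose D hD using hex
  refine ⟨LinearMap.mkContinuous
    { toFun := D
      map_add' := fun f g => HPer.ext_coeff fun n => by
        rw [hD, map_add, coeff_add, coeff_add, hD, hD, mul_add]
      map_smul' := fun c f => HPer.ext_coeff fun n => by
        rw [hD, map_smul, coeff_smul, RingHom.id_apply, coeff_smul, hD]; ring } C
    (fun f => ?_), hD⟩
  change ‖D f‖ ≤ C * ‖f‖
  rw [← sq_le_sq₀ (norm_nonneg _) (by positivity), HPer.norm_sq, mul_pow,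
    ← (hasSum_norm_sq hL f).tsum_eq, ← tsum_mul_left]
  simp only [hD]
  exact (hs f).tsum_le_tsum (hw f) ((hasSum_norm_sq hL f).summable.mul_left _)

/-- Multiplication by a continuous function is a bounded operator on `L²(0, L)`. -/
theorem exists_mul_continuous (L : ℝ) (g : ℝ → ℂ) (hg : Continuous g) :
    ∃ M : L2 L →L[ℂ] L2 L, ∀ (f : ℝ → ℂ) (hf : Continuous f),
      M (ofContinuous L f hf) = ofContinuous L (fun x => g x * f x) (hg.mul hf) := by
  obtain ⟨B, hB⟩ := (isCompact_Icc (a := (0 : ℝ)) (b := L)).exists_bound_of_continuousOn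
    hg.continuousOn
  have hmem : MemLp g ⊤ (vol L) := by
    refine memLp_top_of_bound hg.aestronglyMeasurable B ?_
    filter_upwards [ae_restrict_mem measurableSet_Ioc] with x hx
    exact hB x (Ioc_subset_Icc_self hx)
  refine ⟨(ContinuousLinearMap.mul ℂ ℂ).holderL (vol L) ⊤ 2 2 (hmem.toLp g), fun f hf => ?_⟩
  refine Lp.ext ?_
  have h1 := (ContinuousLinearMap.mul ℂ ℂ).coeFn_holder (r := 2) (hmem.toLp g)
    (ofContinuous L f hf)
  filter_upwards [h1, hmem.coeFn_toLp, coeFn_ofContinuous L f hf,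
    coeFn_ofContinuous L (fun x => g x * f x) (hg.mul hf)] with x h1 h2 h3 h4
  rw [ContinuousLinearMap.holderL_apply_apply, h1, h2, h3, h4]
  rfl

/-! ### The kernels and the transformation -/

theorem lam_add_freq_ne_zero {lam : ℝ} (hlam : 0 < lam) (L : ℝ) (n : ℤ) :
    (lam : ℂ) + freq L n ≠ 0 := by
  intro h
  have h2 := congrArg Complex.re h
  rw [Complex.add_re, freq_re, Complex.ofReal_re, Complex.zero_re] at h2
  linarith

theorem one_sub_exp_pos {L lam : ℝ} (hL : 0 < L) (hlam : 0 < lam) :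
    0 < 1 - Real.exp (-(lam * L)) :=
  sub_pos.2 (Real.exp_lt_one_iff.2 (neg_neg_of_pos (mul_pos hlam hL)))

/-- The integrand is a single exponential, and `e^{p_k L} = 1` turns the end-point difference into
`1 - e^{-λL}`, which the normalisation of `Lam` cancels. -/
theorem coeff_Lam {L lam : ℝ} (hL : 0 < L) (hlam : 0 < lam) (n p : ℤ) :
    coeff (Lam L lam n) p = 1 / ((lam : ℂ) + freq L (n + p)) := by
  have h0 := lam_add_freq_ne_zero hlam L (n + p)
  have hs : ((Real.sqrt L : ℝ) : ℂ) ≠ 0 := by exact_mod_cast (Real.sqrt_pos.2 hL).ne'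
  have hE : (1 - Complex.exp (-(lam * L)) : ℂ) ≠ 0 := by
    exact_mod_cast (one_sub_exp_pos hL hlam).ne'
  rw [Lam, coeff_congr (coeFn_ofContinuous L _ _)]
  have h1 : ∀ x : ℝ, ((Real.sqrt L / (1 - Real.exp (-(lam * L))) : ℝ) : ℂ) *
      Complex.exp (-(((lam : ℂ) + freq L n) * x)) * conj (e L p x)
      = 1 / (1 - Complex.exp (-(lam * L))) *
        Complex.exp (-((lam : ℂ) + freq L (n + p)) * x) := by
    intro x
    rw [conj_e, e, mul_mul_mul_comm, ← Complex.exp_add]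
    congr 1
    · push_cast
      field_simp
    · rw [freq_neg, freq_add]
      ring_nf
  simp_rw [h1]
  rw [integral_const_mul, integral_exp_Ioc hL (neg_ne_zero.2 h0)]
  have h2 : Complex.exp (-((lam : ℂ) + freq L (n + p)) * L) = Complex.exp (-(lam * L)) := by
    rw [neg_mul, add_mul, neg_add, Complex.exp_add, Complex.exp_neg (freq L (n + p) * L),
      exp_freq_mul_period hL]
    simp
  rw [h2]
  field_simp
  ring

/-- All the `Λ^λ_{-n}` are `e_n` times one continuous function independent of `n`; this is the
bounded middle factor of `T`. -/
theorem exists_lamOp {L lam : ℝ} (hL : 0 < L) :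
    ∃ M : L2 L →L[ℂ] L2 L, ∀ n, M (eL2 L n) = Lam L lam (-n) := by
  obtain ⟨M, hM⟩ := exists_mul_continuous L
    (fun x : ℝ => ((L / (1 - Real.exp (-(lam * L))) : ℝ) : ℂ) * Complex.exp (-(lam * x)))
    (by fun_prop)
  refine ⟨M, fun n => ?_⟩
  rw [eL2, hM, Lam]
  congr 1
  ext x
  have h : L = Real.sqrt L * Real.sqrt L := (Real.mul_self_sqrt hL.le).symm
  have h1 : L / (1 - Real.exp (-(lam * L))) * (1 / Real.sqrt L)
      = Real.sqrt L / (1 - Real.exp (-(lam * L))) := by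
    have hs := (Real.sqrt_pos.2 hL).ne'
    rw [div_mul_div_comm, mul_one, mul_comm, ← div_div]
    congr 1
    rw [div_eq_iff hs]; exact h
  rw [← h1, e, mul_mul_mul_comm, ← Complex.exp_add, freq_neg, Complex.ofReal_mul]
  ring_nf

theorem conv_eq_of_coeff {L : ℝ} (hL : 0 < L) {f g h : L2 L}
    (hc : ∀ n, coeff h n = coeff f n * coeff g n) : conv f g = h := by
  rw [conv, ← (hasSum_coeff hL h).tsum_eq]
  simp_rw [hc]

theorem conj_F {L lam : ℝ} (φ : L2 L) (n : ℤ) : conj (F lam φ n) = -(K L lam / coeff φ n) := by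
  rw [F, map_div₀, map_neg, Complex.conj_ofReal, Complex.conj_conj, neg_div]

theorem K_pos {L lam : ℝ} (hL : 0 < L) (hlam : 0 < lam) : 0 < K L lam := by
  have := one_sub_exp_pos hL hlam
  unfold K; positivity

/-- Convolution with `φ` is the Fourier multiplier `D`, which places the kernel in `H^m_per`. -/
theorem kernel_eq {L : ℝ} (hL : 0 < L) {m : ℕ} (lam : ℝ) {φ : L2 L} {D : L2 L →L[ℂ] HPer L m}
    (hD : ∀ f n, coeff (D f).toL2 n = coeff φ n * coeff f n) (n : ℤ) :
    kernel lam φ n = (((K L lam : ℂ) / coeff φ (-n)) • D (Lam L lam n)).toL2 := by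
  rw [kernel, conv_eq_of_coeff hL (h := (D (Lam L lam n)).toL2) (fun p => by rw [hD, mul_comm]),
    conj_F, neg_neg, map_smul]

/-- The lower bound on `φ_n` makes division by it cost at most `√weight`, exactly the regularity
available in `H^m_per`. -/
theorem memlp_coeff_div {L : ℝ} {m : ℕ} {φ : L2 L} {c : ℝ} (hc : 0 < c)
    (hφ : ∀ n, c / Real.sqrt (weight L m n) ≤ ‖coeff φ n‖) (κ : ℂ) (α : HPer L m) :
    Memℓp (fun n => coeff α.toL2 n * (κ / coeff φ n)) 2 := by
  refine memlp_two_iff.2 (Summable.of_nonneg_of_le (fun n => by positivity) (fun n => ?_)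
    (α.summable.mul_left ((‖κ‖ / c) ^ 2)))
  have hw := Real.sqrt_pos.2 (weight_pos L m n)
  have h1 : ‖κ / coeff φ n‖ ≤ ‖κ‖ / c * Real.sqrt (weight L m n) := by
    rw [norm_div]
    calc ‖κ‖ / ‖coeff φ n‖ ≤ ‖κ‖ / (c / Real.sqrt (weight L m n)) := by
          have := hφ n
          gcongr
      _ = _ := by field_simp
  rw [norm_mul, mul_pow]
  calc ‖coeff α.toL2 n‖ ^ 2 * ‖κ / coeff φ n‖ ^ 2
      ≤ ‖coeff α.toL2 n‖ ^ 2 * (‖κ‖ / c * Real.sqrt (weight L m n)) ^ 2 := by gcongr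
    _ = _ := by rw [mul_pow, Real.sq_sqrt (weight_pos L m n).le]; ring

/-- The series is the image under the bounded operator `D ∘ M` of the basis expansion of the `L²`
function with coefficients `K α_n / φ_n`. -/
theorem hasSum_T {L lam : ℝ} (hL : 0 < L) {m : ℕ} {φ : L2 L} {c C : ℝ}
    (hc : 0 < c) (hφ1 : ∀ n, c / Real.sqrt (weight L m n) ≤ ‖coeff φ n‖)
    (hφ2 : ∀ n, ‖coeff φ n‖ ≤ C / Real.sqrt (weight L m n)) (α : HPer L m) :
    HasSum (fun n : ℤ => coeff α.toL2 n • toHPer m (kernel lam φ (-n))) (T m lam φ α) := by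
  obtain ⟨D, hD⟩ := exists_multiplier hL m (coeff φ) C hφ2
  obtain ⟨M, hM⟩ := exists_lamOp (lam := lam) hL
  obtain ⟨f, hf⟩ := exists_coeff_eq hL (memlp_coeff_div hc hφ1 (K L lam : ℂ) α)
  have h := (hasSum_coeff hL f).mapL (D.comp M)
  have h2 : ∀ n : ℤ, (D.comp M) (coeff f n • eL2 L n)
      = coeff α.toL2 n • toHPer m (kernel lam φ (-n)) := by
    intro n
    have h3 : toHPer m (kernel lam φ (-n)) = ((K L lam : ℂ) / coeff φ n) • D (Lam L lam (-n)) := by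
      refine HPer.ext_coeff fun p => ?_
      have hk := kernel_eq hL lam hD (-n)
      rw [neg_neg] at hk
      rw [toHPer_toL2 (hk ▸ HPer.toL2_mem _), hk]
    rw [ContinuousLinearMap.comp_apply, map_smul, map_smul, hM, hf, h3, smul_smul]
  simp_rw [h2] at h
  exact h.summable.hasSum

theorem kernel_mem {L : ℝ} (hL : 0 < L) {m : ℕ} (lam : ℝ) {φ : L2 L} {C : ℝ}
    (hφ2 : ∀ n, ‖coeff φ n‖ ≤ C / Real.sqrt (weight L m n)) (n : ℤ) :
    kernel lam φ n ∈ sobolevPer L m := by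
  obtain ⟨D, hD⟩ := exists_multiplier hL m (coeff φ) C hφ2
  exact kernel_eq hL lam hD n ▸ HPer.toL2_mem _

theorem coeff_kernel {L lam : ℝ} (hL : 0 < L) (hlam : 0 < lam) {m : ℕ} {φ : L2 L} {C : ℝ}
    (hφ2 : ∀ n, ‖coeff φ n‖ ≤ C / Real.sqrt (weight L m n)) (n p : ℤ) :
    coeff (kernel lam φ n) p
      = K L lam / coeff φ (-n) * (coeff φ p * (1 / ((lam : ℂ) + freq L (n + p)))) := by
  obtain ⟨D, hD⟩ := exists_multiplier hL m (coeff φ) C hφ2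
  rw [kernel_eq hL lam hD, map_smul, coeff_smul, hD, coeff_Lam hL hlam]

/-- Fourier coefficients are continuous on `H^m_per`, so they may be taken term by term. -/
theorem hasSum_coeff_T {L lam : ℝ} (hL : 0 < L) (hlam : 0 < lam) {m : ℕ} {φ : L2 L} {c C : ℝ}
    (hc : 0 < c) (hφ1 : ∀ n, c / Real.sqrt (weight L m n) ≤ ‖coeff φ n‖)
    (hφ2 : ∀ n, ‖coeff φ n‖ ≤ C / Real.sqrt (weight L m n)) (α : HPer L m) (p : ℤ) :
    HasSum (fun n : ℤ => coeff α.toL2 n *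
      (K L lam / coeff φ n * (coeff φ p * (1 / ((lam : ℂ) + freq L (p - n))))))
      (coeff (T m lam φ α).toL2 p) := by
  have h := (hasSum_T (lam := lam) hL hc hφ1 hφ2 α).mapL (HPer.coeffL hL m p)
  simp only [HPer.coeffL_apply, map_smul,
    toHPer_toL2 (kernel_mem hL lam hφ2 _), coeff_kernel hL hlam hφ2, neg_neg] at h
  convert h using 6
  ring_nf

/-! ### Test functions -/

/-- The real test functions on `(a, b)`. -/
structure IsTest (a b : ℝ) (ψ : ℝ → ℝ) : Prop where
  contDiff : ContDiff ℝ ∞ ψ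
  compact : HasCompactSupport ψ
  subset : tsupport ψ ⊆ Ioo a b

namespace IsTest

variable {a b : ℝ} {ψ : ℝ → ℝ}

theorem deriv (h : IsTest a b ψ) : IsTest a b (deriv ψ) :=
  ⟨(contDiff_infty_iff_deriv.1 h.contDiff).2, h.compact.deriv,
    tsupport_deriv_subset.trans h.subset⟩

theorem iteratedDeriv (h : IsTest a b ψ) (k : ℕ) : IsTest a b (iteratedDeriv k ψ) := by
  induction k with
  | zero => rwa [iteratedDeriv_zero]
  | succ k ih => rw [iteratedDeriv_succ]; exact ih.deriv

theorem continuous (h : IsTest a b ψ) : Continuous ψ := h.contDiff.continuous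

theorem eq_zero (h : IsTest a b ψ) {x : ℝ} (hx : x ∉ Ioo a b) : ψ x = 0 :=
  image_eq_zero_of_notMem_tsupport fun hx' => hx (h.subset hx')

theorem hasDerivAt (h : IsTest a b ψ) (x : ℝ) : HasDerivAt ψ (_root_.deriv ψ x) x :=
  ((contDiff_infty_iff_deriv.1 h.contDiff).1 x).hasDerivAt

theorem exists_bound (h : IsTest a b ψ) : ∃ C, ∀ x, ‖ψ x‖ ≤ C :=
  h.compact.exists_bound_of_continuous h.continuous

theorem integrable_smul (h : IsTest a b ψ) {f : ℝ → ℂ} {s : Set ℝ} (hf : IntegrableOn f s) :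
    IntegrableOn (fun x => ψ x • f x) s := by
  obtain ⟨C, hC⟩ := h.exists_bound
  exact Integrable.bdd_smul hf C h.continuous.aestronglyMeasurable (ae_of_all _ hC)

theorem sub_const_mul {χ : ℝ → ℝ} (h : IsTest a b ψ) (h' : IsTest a b χ) (r : ℝ) :
    IsTest a b (fun x => ψ x - r * χ x) := by
  have hs : tsupport (fun x => ψ x - r * χ x) ⊆ tsupport ψ ∪ tsupport χ := by
    refine closure_minimal (fun x hx => ?_) (isClosed_closure.union isClosed_closure)
    by_contra hx'
    rw [mem_union, not_or] at hx'
    exact hx (by simp [image_eq_zero_of_notMem_tsupport hx'.1,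
      image_eq_zero_of_notMem_tsupport hx'.2])
  refine ⟨h.contDiff.sub (contDiff_const.mul h'.contDiff), ?_, hs.trans (union_subset h.subset
    h'.subset)⟩
  exact (h.compact.isCompact.union h'.compact.isCompact).of_isClosed_subset isClosed_closure hs

/-- The primitive starting at `a` vanishes to the left of the support, and the zero mean makes it
vanish to the right. -/
theorem exists_deriv_eq (hab : a < b) (h : IsTest a b ψ) (h0 : ∫ x, ψ x = 0) :
    ∃ Θ : ℝ → ℝ, IsTest a b Θ ∧ _root_.deriv Θ = ψ := by
  -- The midpoint is inserted so that least and greatest elements exist even when `ψ = 0`.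
  have hK : IsCompact (insert ((a + b) / 2) (tsupport ψ)) := h.compact.isCompact.insert _
  have hKs : insert ((a + b) / 2) (tsupport ψ) ⊆ Ioo a b :=
    insert_subset ⟨by linarith, by linarith⟩ h.subset
  obtain ⟨a', ha', ha''⟩ := hK.exists_isLeast (insert_nonempty _ _)
  obtain ⟨b', hb', hb''⟩ := hK.exists_isGreatest (insert_nonempty _ _)
  have hlow : ∀ t < a', ψ t = 0 := fun t ht => image_eq_zero_of_notMem_tsupport fun h' =>
    absurd (ha'' (mem_insert_of_mem _ h')) (not_le.2 ht)
  have hhigh : ∀ t > b', ψ t = 0 := fun t ht => image_eq_zero_of_notMem_tsupport fun h' =>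
    absurd (hb'' (mem_insert_of_mem _ h')) (not_le.2 ht)
  have hd : ∀ x, HasDerivAt (fun x => ∫ t in a..x, ψ t) (ψ x) x := fun x =>
    intervalIntegral.integral_hasDerivAt_right (h.continuous.intervalIntegrable _ _)
      h.continuous.stronglyMeasurable.stronglyMeasurableAtFilter h.continuous.continuousAt
  have hde : _root_.deriv (fun x => ∫ t in a..x, ψ t) = ψ := funext fun x => (hd x).deriv
  have hs : tsupport (fun x => ∫ t in a..x, ψ t) ⊆ Icc a' b' := by
    refine closure_minimal (fun x hx => ?_) isClosed_Icc
    by_contra hx'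
    apply hx
    rw [mem_Icc, not_and_or, not_le, not_le] at hx'
    rcases hx' with hx' | hx'
    · refine intervalIntegral.integral_zero_ae (ae_of_all _ fun t ht => hlow t ?_)
      exact ht.2.trans_lt (max_lt (hKs ha').1 hx')
    · have h1 : ∫ t in b..x, ψ t = 0 := by
        refine intervalIntegral.integral_zero_ae (ae_of_all _ fun t ht => hhigh t ?_)
        exact (lt_min (hKs hb').2 hx').trans ht.1
      have h2 : ∫ t in a..b, ψ t = 0 := by
        rw [intervalIntegral.integral_of_le hab.le, ← h0]
        exact setIntegral_eq_integral_of_forall_compl_eq_zero fun t ht =>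
          h.eq_zero fun ht' => ht (Ioo_subset_Ioc_self ht')
      change ∫ t in a..x, ψ t = 0
      rw [← intervalIntegral.integral_add_adjacent_intervals
        (h.continuous.intervalIntegrable a b) (h.continuous.intervalIntegrable b x), h1, h2,
        add_zero]
  refine ⟨_, ⟨contDiff_infty_iff_deriv.2 ⟨fun x => (hd x).differentiableAt, ?_⟩,
    isCompact_Icc.of_isClosed_subset isClosed_closure hs,
    hs.trans (Icc_subset_Ioo (hKs ha').1 (hKs hb').2)⟩, hde⟩
  rw [hde]
  exact h.contDiff

end IsTest

theorem exists_isTest_integral_eq_one {a b : ℝ} (hab : a < b) :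
    ∃ ψ : ℝ → ℝ, IsTest a b ψ ∧ ∫ x, ψ x = 1 := by
  let B : ContDiffBump ((a + b) / 2) := ⟨(b - a) / 8, (b - a) / 4, by linarith, by linarith⟩
  refine ⟨B.normed volume, ⟨B.contDiff_normed, B.hasCompactSupport_normed, ?_⟩,
    B.integral_normed⟩
  rw [B.tsupport_normed_eq, Real.closedBall_eq_Icc]
  exact Icc_subset_Ioo (by change a < _ - (b - a) / 4; linarith)
    (by change _ + (b - a) / 4 < b; linarith)

/-! ### Weak derivatives -/

/-- A function whose weak derivative vanishes is constant. -/
theorem ae_eq_const_of_weakDeriv_zero {a b : ℝ} (hab : a < b) {f : ℝ → ℂ}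
    (hf : IntegrableOn f (Ioo a b))
    (h : ∀ ψ : ℝ → ℝ, IsTest a b ψ → ∫ x in Ioo a b, deriv ψ x • f x = 0) :
    ∃ c : ℂ, ∀ᵐ x ∂(volume.restrict (Ioo a b)), f x = c := by
  obtain ⟨χ, hχ, hχ1⟩ := exists_isTest_integral_eq_one hab
  have hint : ∀ ψ : ℝ → ℝ, IsTest a b ψ → Integrable ψ := fun ψ hψ =>
    hψ.continuous.integrable_of_hasCompactSupport hψ.compact
  have hset : ∀ ψ : ℝ → ℝ, IsTest a b ψ → ∫ x in Ioo a b, ψ x = ∫ x, ψ x := fun ψ hψ =>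
    setIntegral_eq_integral_of_forall_compl_eq_zero fun x hx => hψ.eq_zero hx
  refine ⟨∫ x in Ioo a b, χ x • f x, ?_⟩
  set c := ∫ x in Ioo a b, χ x • f x with hc
  have hfc : IntegrableOn (fun x => f x - c) (Ioo a b) := hf.sub (integrableOn_const measure_Ioo_lt_top.ne)
  have key := IsOpen.ae_eq_zero_of_integral_contDiff_smul_eq_zero (μ := volume.restrict (Ioo a b))
    (f := fun x => f x - c) isOpen_Ioo (hfc.restrict.locallyIntegrableOn) ?_
  · filter_upwards [key, ae_restrict_mem measurableSet_Ioo] with x hx hx'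
    exact sub_eq_zero.1 (hx hx')
  · intro ψ hψ1 hψ2 hψ3
    have hψ : IsTest a b ψ := ⟨hψ1, hψ2, hψ3⟩
    -- Removing the mean of `ψ` along the fixed bump `χ` leaves a derivative of a test function, on
    -- which the hypothesis applies.
    have hη := hψ.sub_const_mul hχ (∫ x, ψ x)
    obtain ⟨Θ, hΘ, hΘ'⟩ := hη.exists_deriv_eq hab (by
      rw [integral_sub (hint ψ hψ) ((hint χ hχ).const_mul _), integral_const_mul, hχ1, mul_one,
        sub_self])
    have h1 := h Θ hΘ
    rw [hΘ'] at h1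
    have h2 : ∀ x, (ψ x - (∫ y, ψ y) * χ x) • f x = ψ x • f x - (∫ y, ψ y) • (χ x • f x) :=
      fun x => by rw [sub_smul, mul_smul]
    simp_rw [h2] at h1
    have h3 : IntegrableOn (fun x => (∫ y, ψ y) • (χ x • f x)) (Ioo a b) :=
      (hχ.integrable_smul hf).smul (∫ y, ψ y)
    rw [integral_sub (hψ.integrable_smul hf) h3, integral_smul, ← hc] at h1
    simp_rw [smul_sub]
    rw [integral_sub (hψ.integrable_smul hf) 
      (hψ.integrable_smul (integrableOn_const measure_Ioo_lt_top.ne)),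
      integral_smul_const, hset ψ hψ, h1]

/-- Integration by parts against an indefinite integral. -/
theorem integral_deriv_mul_integral {a b : ℝ} (hab : a ≤ b) {u u' h : ℝ → ℂ}
    (hu : ∀ x, HasDerivAt u (u' x) x) (hu' : Continuous u')
    (hh : IntegrableOn h (Ioc a b)) :
    ∫ x in a..b, u' x * ∫ t in a..x, h t
      = u b * (∫ t in a..b, h t) - ∫ x in a..b, u x * h x := by
  have hcu : Continuous u := continuous_iff_continuousAt.2 fun x => (hu x).continuousAt
  have hu'i : IntegrableOn u' (Ioc a b) :=
    (hu'.integrableOn_Icc (a := a) (b := b)).mono_set Ioc_subset_Icc_self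
  -- Fubini on the triangle `t ≤ x`; no regularity of `h` beyond integrability is needed.
  have hF : Integrable (Function.uncurry fun x t : ℝ =>
      {q : ℝ × ℝ | q.2 ≤ q.1}.indicator (fun q => u' q.1 * h q.2) (x, t))
      ((volume.restrict (Ioc a b)).prod (volume.restrict (Ioc a b))) :=
    (Integrable.mul_prod hu'i hh).indicator (measurableSet_le measurable_snd measurable_fst)
  have hswap := integral_integral_swap hF
  have hleft : ∀ x ∈ Ioc a b, ∫ t in Ioc a b,
      {q : ℝ × ℝ | q.2 ≤ q.1}.indicator (fun q => u' q.1 * h q.2) (x, t)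
      = u' x * ∫ t in a..x, h t := by
    intro x hx
    have h1 : (fun t => {q : ℝ × ℝ | q.2 ≤ q.1}.indicator (fun q => u' q.1 * h q.2) (x, t))
        = (Iic x).indicator fun t => u' x * h t := by
      ext t; simp [indicator_apply]
    rw [h1, setIntegral_indicator measurableSet_Iic, integral_const_mul,
      intervalIntegral.integral_of_le hx.1.le, Ioc_inter_Iic, min_eq_right hx.2]
  have hright : ∀ t ∈ Ioc a b, ∫ x in Ioc a b,
      {q : ℝ × ℝ | q.2 ≤ q.1}.indicator (fun q => u' q.1 * h q.2) (x, t)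
      = u b * h t - u t * h t := by
    intro t ht
    have h1 : (fun x => {q : ℝ × ℝ | q.2 ≤ q.1}.indicator (fun q => u' q.1 * h q.2) (x, t))
        = (Ici t).indicator fun x => u' x * h t := by
      ext x; simp [indicator_apply]
    have h2 : Ioc a b ∩ Ici t = Icc t b := by
      ext x; simp only [mem_inter_iff, mem_Ioc, mem_Ici, mem_Icc]
      exact ⟨fun hx => ⟨hx.2, hx.1.2⟩, fun hx => ⟨⟨ht.1.trans_le hx.1, hx.2⟩, hx.1⟩⟩
    rw [h1, setIntegral_indicator measurableSet_Ici, h2, integral_mul_const,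
      integral_Icc_eq_integral_Ioc, ← intervalIntegral.integral_of_le ht.2,
      intervalIntegral.integral_eq_sub_of_hasDerivAt (fun x _ => hu x)
        (hu'.intervalIntegrable _ _), sub_mul]
  have huh : IntegrableOn (fun t => u t * h t) (Ioc a b) := by
    obtain ⟨C, hC⟩ := (isCompact_Icc (a := a) (b := b)).exists_bound_of_continuousOn
      hcu.continuousOn
    refine Integrable.bdd_mul hh hcu.aestronglyMeasurable (c := C) ?_
    filter_upwards [ae_restrict_mem measurableSet_Ioc] with x hx
    exact hC x (Ioc_subset_Icc_self hx)
  rw [setIntegral_congr_fun measurableSet_Ioc hleft,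
    setIntegral_congr_fun measurableSet_Ioc hright, integral_sub (hh.const_mul _) huh,
    integral_const_mul] at hswap
  rw [intervalIntegral.integral_of_le hab, intervalIntegral.integral_of_le hab,
    intervalIntegral.integral_of_le hab, hswap]

/-- A function with an integrable weak derivative is the indefinite integral of it. -/
theorem ae_eq_integral_of_weakDeriv {a b : ℝ} (hab : a < b) {g h : ℝ → ℂ}
    (hg : IntegrableOn g (Ioo a b)) (hh : IntegrableOn h (Ioo a b))
    (hw : ∀ ψ : ℝ → ℝ, IsTest a b ψ →
      ∫ x in Ioo a b, deriv ψ x • g x = -∫ x in Ioo a b, ψ x • h x) :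
    ∃ c : ℂ, ∀ᵐ x ∂(volume.restrict (Ioo a b)), g x = c + ∫ t in a..x, h t := by
  have hh' : IntegrableOn h (Icc a b) := (integrableOn_Icc_iff_integrableOn_Ioo).2 hh
  have hHc : ContinuousOn (fun x => ∫ t in a..x, h t) (Icc a b) :=
    intervalIntegral.continuousOn_primitive_interval (by rwa [uIcc_of_le hab.le]) |>.mono
      (by rw [uIcc_of_le hab.le])
  have hHi : IntegrableOn (fun x => ∫ t in a..x, h t) (Ioo a b) :=
    hHc.integrableOn_Icc.mono_set Ioo_subset_Icc_self
  -- The difference between `g` and the primitive of `h` has zero weak derivative.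
  obtain ⟨c, hc⟩ := ae_eq_const_of_weakDeriv_zero hab (hg.sub hHi) (fun ψ hψ => by
    simp only [Pi.sub_apply, smul_sub]
    rw [integral_sub (hψ.deriv.integrable_smul hg) (hψ.deriv.integrable_smul hHi), hw ψ hψ]
    have h1 := integral_deriv_mul_integral hab.le (u := fun x => (ψ x : ℂ))
      (u' := fun x => ((deriv ψ x : ℝ) : ℂ)) (fun x => (hψ.hasDerivAt x).ofReal_comp)
      (Complex.continuous_ofReal.comp hψ.deriv.continuous) (hh'.mono_set Ioc_subset_Icc_self)
    rw [hψ.eq_zero (fun hb => lt_irrefl _ hb.2), Complex.ofReal_zero, zero_mul, zero_sub,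
      intervalIntegral.integral_of_le hab.le, intervalIntegral.integral_of_le hab.le,
      integral_Ioc_eq_integral_Ioo, integral_Ioc_eq_integral_Ioo] at h1
    simp_rw [Complex.real_smul]
    rw [h1, sub_self])
  refine ⟨c, ?_⟩
  filter_upwards [hc] with x hx
  rw [← hx, Pi.sub_apply, sub_add_cancel]

/-- The weak derivative is unique. -/
theorem HasWeakDeriv.ae_eq {a b : ℝ} {k : ℕ} {f g g' : ℝ → ℂ} (h : HasWeakDeriv a b k f g)
    (h' : HasWeakDeriv a b k f g') : g =ᵐ[volume.restrict (Ioo a b)] g' := by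
  have key := IsOpen.ae_eq_zero_of_integral_contDiff_smul_eq_zero (μ := volume.restrict (Ioo a b))
    (f := fun x => g x - g' x) isOpen_Ioo
    ((h.2.1.sub h'.2.1).restrict.locallyIntegrableOn) ?_
  · filter_upwards [key, ae_restrict_mem measurableSet_Ioo] with x hx hx'
    exact sub_eq_zero.1 (hx hx')
  · intro ψ hψ1 hψ2 hψ3
    have hψ : IsTest a b ψ := ⟨hψ1, hψ2, hψ3⟩
    have h1 := (h.2.2 ψ hψ1 hψ2 hψ3).symm.trans (h'.2.2 ψ hψ1 hψ2 hψ3)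
    simp_rw [smul_sub]
    rw [integral_sub (hψ.integrable_smul h.2.1) (hψ.integrable_smul h'.2.1), sub_eq_zero]
    exact mul_left_cancel₀ (pow_ne_zero k (neg_ne_zero.2 one_ne_zero)) h1

theorem HasWeakDeriv.mono {a b a' b' : ℝ} {k : ℕ} {f g : ℝ → ℂ} (h : HasWeakDeriv a b k f g)
    (ha : a ≤ a') (hb : b' ≤ b) : HasWeakDeriv a' b' k f g := by
  have hs := Ioo_subset_Ioo ha hb
  refine ⟨h.1.mono_set hs, h.2.1.mono_set hs, fun ψ hψ1 hψ2 hψ3 => ?_⟩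
  have hψ : IsTest a' b' ψ := ⟨hψ1, hψ2, hψ3⟩
  have h1 := h.2.2 ψ hψ1 hψ2 (hψ3.trans hs)
  have hres : ∀ (χ : ℝ → ℝ) (u : ℝ → ℂ), IsTest a' b' χ →
      ∫ x in Ioo a b, χ x • u x = ∫ x in Ioo a' b', χ x • u x := by
    intro χ u hχ
    refine setIntegral_eq_of_subset_of_forall_sdiff_eq_zero measurableSet_Ioo hs fun x hx => ?_
    rw [hχ.eq_zero hx.2, zero_smul]
  rwa [hres _ _ (hψ.iteratedDeriv k), hres _ _ hψ] at h1

theorem HasWeakDeriv.congr {a b : ℝ} {k : ℕ} {f g g' : ℝ → ℂ} (h : HasWeakDeriv a b k f g)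
    (hg : g =ᵐ[volume.restrict (Ioo a b)] g') : HasWeakDeriv a b k f g' := by
  refine ⟨h.1, h.2.1.congr hg, fun ψ hψ1 hψ2 hψ3 => ?_⟩
  rw [h.2.2 ψ hψ1 hψ2 hψ3]
  congr 1
  refine integral_congr_ae ?_
  filter_upwards [hg] with x hx
  rw [hx]

theorem eqOn_Icc_of_ae_eq_Ioo {a b : ℝ} (hab : a < b) {g g' : ℝ → ℂ}
    (h : g =ᵐ[volume.restrict (Ioo a b)] g') (hg : ContinuousOn g (Icc a b))
    (hg' : ContinuousOn g' (Icc a b)) : EqOn g g' (Icc a b) := by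
  refine Measure.eqOn_of_ae_eq (μ := volume) ?_ hg hg' (closure_interior_Icc hab.ne).ge
  rwa [← Measure.restrict_congr_set (μ := volume) (Ioo_ae_eq_Icc (a := a) (b := b))]

/-- Both representatives agree almost everywhere on the smaller interval, and continuity up to the
end point forces equal values. This makes the chosen value in `rightValue` independent of the
choice. -/
theorem HasRightValue.unique {k : ℕ} {f : ℝ → ℂ} {x : ℝ} {c c' : ℂ} (h : HasRightValue k f x c)
    (h' : HasRightValue k f x c') : c = c' := by
  obtain ⟨b, hb, g, hg, hw, rfl⟩ := h
  obtain ⟨b', hb', g', hg', hw', rfl⟩ := h'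
  have hm : x < min b b' := lt_min hb hb'
  exact eqOn_Icc_of_ae_eq_Ioo hm ((hw.mono le_rfl (min_le_left _ _)).ae_eq
    (hw'.mono le_rfl (min_le_right _ _))) (hg.mono (Icc_subset_Icc_right (min_le_left _ _)))
    (hg'.mono (Icc_subset_Icc_right (min_le_right _ _))) (left_mem_Icc.2 hm.le)

theorem HasLeftValue.unique {k : ℕ} {f : ℝ → ℂ} {x : ℝ} {c c' : ℂ} (h : HasLeftValue k f x c)
    (h' : HasLeftValue k f x c') : c = c' := by
  obtain ⟨a, ha, g, hg, hw, rfl⟩ := h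
  obtain ⟨a', ha', g', hg', hw', rfl⟩ := h'
  have hm : max a a' < x := max_lt ha ha'
  exact eqOn_Icc_of_ae_eq_Ioo hm ((hw.mono (le_max_left _ _) le_rfl).ae_eq
    (hw'.mono (le_max_right _ _) le_rfl)) (hg.mono (Icc_subset_Icc_left (le_max_left _ _)))
    (hg'.mono (Icc_subset_Icc_left (le_max_right _ _))) (right_mem_Icc.2 hm.le)

theorem HasRightValue.rightValue_eq {k : ℕ} {f : ℝ → ℂ} {x : ℝ} {c : ℂ}
    (h : HasRightValue k f x c) : rightValue k f x = c := by
  have hex : ∃ c, HasRightValue k f x c := ⟨c, h⟩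
  rw [rightValue, dif_pos hex]
  exact hex.choose_spec.unique h

theorem HasLeftValue.leftValue_eq {k : ℕ} {f : ℝ → ℂ} {x : ℝ} {c : ℂ}
    (h : HasLeftValue k f x c) : leftValue k f x = c := by
  have hex : ∃ c, HasLeftValue k f x c := ⟨c, h⟩
  rw [leftValue, dif_pos hex]
  exact hex.choose_spec.unique h

/-! ### The periodic derivative -/

theorem hasDerivAt_e (L : ℝ) (n : ℤ) (x : ℝ) : HasDerivAt (e L n) (freq L n * e L n x) x := by
  have h1 : HasDerivAt (fun y : ℝ => freq L n * (y : ℂ)) (freq L n) x := by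
    simpa using (hasDerivAt_id x).ofReal_comp.const_mul (freq L n)
  have h2 := (h1.cexp).const_mul ((1 / Real.sqrt L : ℝ) : ℂ)
  have h3 : freq L n * e L n x = ((1 / Real.sqrt L : ℝ) : ℂ) *
      (Complex.exp (freq L n * x) * freq L n) := by rw [e]; ring
  rw [h3]
  exact h2

theorem IsTest.continuous_ofReal {a b : ℝ} {ψ : ℝ → ℝ} (h : IsTest a b ψ) :
    Continuous fun x => (ψ x : ℂ) :=
  Complex.continuous_ofReal.comp h.continuous

/-- Integration by parts without boundary terms, since `ψ` vanishes at `0` and `L`. -/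
theorem coeff_deriv_isTest {L : ℝ} (hL : 0 < L) {ψ : ℝ → ℝ} (h : IsTest 0 L ψ) (n : ℤ) :
    coeff (ofContinuous L _ h.deriv.continuous_ofReal) n
      = freq L n * coeff (ofContinuous L _ h.continuous_ofReal) n := by
  rw [coeff_congr (coeFn_ofContinuous L _ _), coeff_congr (coeFn_ofContinuous L _ _)]
  simp_rw [conj_e]
  have hc : Continuous fun x => freq L (-n) * e L (-n) x :=
    continuous_const.mul (continuous_e L (-n))
  have h1 := intervalIntegral.integral_mul_deriv_eq_deriv_mul (a := 0) (b := L)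
    (fun x _ => hasDerivAt_e L (-n) x) (fun x _ => (h.hasDerivAt x).ofReal_comp)
    (hc.intervalIntegrable _ _) (h.deriv.continuous_ofReal.intervalIntegrable _ _)
  rw [h.eq_zero (fun hx => lt_irrefl _ hx.1), h.eq_zero (fun hx => lt_irrefl _ hx.2),
    intervalIntegral.integral_of_le hL.le, intervalIntegral.integral_of_le hL.le] at h1
  simp only [Complex.ofReal_zero, mul_zero, sub_zero, zero_sub] at h1
  simp_rw [mul_comm (e L (-n) _)] at h1
  rw [h1, ← integral_const_mul, ← integral_neg]
  refine integral_congr_ae (ae_of_all _ fun x => ?_)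
  simp only [freq_neg]
  ring

theorem coeff_iteratedDeriv_isTest {L : ℝ} (hL : 0 < L) {ψ : ℝ → ℝ} (h : IsTest 0 L ψ) (k : ℕ)
    (n : ℤ) : coeff (ofContinuous L _ (h.iteratedDeriv k).continuous_ofReal) n
      = freq L n ^ k * coeff (ofContinuous L _ h.continuous_ofReal) n := by
  induction k with
  | zero => simp [iteratedDeriv_zero]
  | succ k ih =>
    rw [pow_succ', mul_assoc, ← ih, ← coeff_deriv_isTest hL (h.iteratedDeriv k)]
    simp only [iteratedDeriv_succ]

theorem integral_isTest_smul {L : ℝ} {ψ : ℝ → ℝ} (h : IsTest 0 L ψ) (f : L2 L) :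
    ∫ x in Ioo 0 L, ψ x • f x = inner ℂ (ofContinuous L _ h.continuous_ofReal) f := by
  rw [L2.inner_def, ← integral_Ioc_eq_integral_Ioo]
  refine integral_congr_ae ?_
  filter_upwards [coeFn_ofContinuous L _ h.continuous_ofReal] with x hx
  rw [hx, RCLike.inner_apply, Complex.conj_ofReal, Complex.real_smul, mul_comm]

theorem integrableOn_of_subset {L : ℝ} (f : L2 L) {a b : ℝ} (ha : 0 ≤ a) (hb : b ≤ L) :
    IntegrableOn f (Ioo a b) := by
  have h : IntegrableOn f (Ioc 0 L) := (Lp.memLp f).integrable (by norm_num)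
  exact h.mono_set ((Ioo_subset_Ioo ha hb).trans Ioo_subset_Ioc_self)

/-- Parseval against a test function; the sign `(-1)^k` arises from `conj p_n = -p_n`. -/
theorem hasWeakDeriv_of_coeff {L : ℝ} (hL : 0 < L) {k : ℕ} {f g : L2 L}
    (h : ∀ n, coeff g n = freq L n ^ k * coeff f n) : HasWeakDeriv 0 L k f g := by
  refine ⟨integrableOn_of_subset f le_rfl le_rfl, integrableOn_of_subset g le_rfl le_rfl,
    fun ψ h1 h2 h3 => ?_⟩
  have hψ : IsTest 0 L ψ := ⟨h1, h2, h3⟩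
  rw [integral_isTest_smul (hψ.iteratedDeriv k), integral_isTest_smul hψ,
    ← (basis hL).tsum_inner_mul_inner, ← (basis hL).tsum_inner_mul_inner, ← tsum_mul_left]
  refine tsum_congr fun n => ?_
  rw [basis_apply, ← inner_conj_symm, ← inner_conj_symm _ (eL2 L n)]
  change conj (coeff _ n) * coeff f n = (-1) ^ k * (conj (coeff _ n) * coeff g n)
  rw [coeff_iteratedDeriv_isTest hL hψ, h, map_mul, map_pow, conj_freq, neg_pow]
  ring

theorem exists_periodic_deriv {L : ℝ} (hL : 0 < L) {k : ℕ} {f : L2 L} (hf : f ∈ sobolevPer L k) :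
    ∃ g : L2 L, ∀ n, coeff g n = freq L n ^ k * coeff f n := by
  refine exists_coeff_eq hL (memlp_two_iff.2 (Summable.of_nonneg_of_le (fun n => by positivity)
    (fun n => ?_) (mem_sobolevPer_iff.1 hf)))
  rw [norm_mul, mul_pow, norm_pow]
  gcongr
  rw [weight, ← pow_mul, mul_comm k 2]
  linarith

/-! ### Piecewise Sobolev functions -/

theorem continuousOn_primitive_Ioo {a b : ℝ} (hab : a ≤ b) {h : ℝ → ℂ}
    (hh : IntegrableOn h (Ioo a b)) (c : ℂ) :
    ContinuousOn (fun x => c + ∫ t in a..x, h t) (Icc a b) := by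
  have hh' : IntegrableOn h (Icc a b) := (integrableOn_Icc_iff_integrableOn_Ioo).2 hh
  have := intervalIntegral.continuousOn_primitive_interval (μ := volume) (f := h) (a := a) (b := b)
    (by rwa [uIcc_of_le hab])
  rw [uIcc_of_le hab] at this
  exact continuousOn_const.add this

/-- On each piece, the `k`-th derivative of a function in `H^k_per` which is piecewise `H^{k+1}` is
an indefinite integral of an `L²` function, with the one-sided values at the ends. -/
theorem exists_primitive_on_piece {L : ℝ} (hL : 0 < L) {k : ℕ} {f g : L2 L}
    (hg : ∀ n, coeff g n = freq L n ^ k * coeff f n) {a b : ℝ} (ha : 0 ≤ a) (hab : a < b)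
    (hb : b ≤ L) (hf : MemSobolev a b (k + 1) f) :
    ∃ h : ℝ → ℂ, MemLp h 2 (volume.restrict (Ioo a b)) ∧
      (∀ᵐ x ∂(volume.restrict (Ioo a b)), g x = rightValue k f a + ∫ t in a..x, h t) ∧
      leftValue k f b = rightValue k f a + ∫ t in a..b, h t := by
  obtain ⟨h, hh, hw⟩ := hf (k + 1) le_rfl
  have hwk : HasWeakDeriv a b k f g := (hasWeakDeriv_of_coeff hL hg).mono ha hb
  -- Comparing the weak derivatives of order `k` (tested against `ψ'`) and `k + 1` (tested against
  -- `ψ`) shows that `h` is the weak derivative of `g`.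
  obtain ⟨c, hc⟩ := ae_eq_integral_of_weakDeriv hab hwk.2.1 hw.2.1 (fun ψ hψ => by
    have h1 := hw.2.2 ψ hψ.contDiff hψ.compact hψ.subset
    rw [iteratedDeriv_succ', hwk.2.2 _ hψ.deriv.contDiff hψ.deriv.compact hψ.deriv.subset,
      pow_succ, mul_assoc, neg_one_mul] at h1
    exact mul_left_cancel₀ (pow_ne_zero k (neg_ne_zero.2 one_ne_zero)) h1)
  have hcont := continuousOn_primitive_Ioo hab.le hw.2.1 c
  have hr : rightValue k f a = c :=
    HasRightValue.rightValue_eq ⟨b, hab, _, hcont, hwk.congr hc, by simp⟩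
  have hl : leftValue k f b = c + ∫ t in a..b, h t :=
    HasLeftValue.leftValue_eq ⟨a, hab, _, hcont, hwk.congr hc, rfl⟩
  exact ⟨h, hh, by rwa [hr], by rw [hl, hr]⟩

/-- Cauchy–Schwarz, with the `L²` norm over the whole interval as a uniform constant: primitives of
`L²` functions are Hölder-`1/2`. -/
theorem norm_integral_le_sqrt {a b : ℝ} {h : ℝ → ℂ}
    (hh : MemLp h 2 (volume.restrict (Ioo a b))) :
    ∃ M : ℝ, 0 ≤ M ∧ ∀ s t, a ≤ s → s ≤ t → t ≤ b →
      ‖∫ x in s..t, h x‖ ≤ M * Real.sqrt (t - s) := by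
  have hsq : IntegrableOn (fun x => ‖h x‖ ^ 2) (Ioc a b) := by
    rw [integrableOn_Ioc_iff_integrableOn_Ioo]
    exact (memLp_two_iff_integrable_sq_norm hh.1).1 hh
  refine ⟨Real.sqrt (∫ x in Ioc a b, ‖h x‖ ^ 2), Real.sqrt_nonneg _, fun s t hs hst ht => ?_⟩
  rw [intervalIntegral.integral_of_le hst]
  have hh' : MemLp h 2 (volume.restrict (Ioc s t)) := by
    rw [← restrict_Ioo_eq_restrict_Ioc]
    exact hh.mono_measure (Measure.restrict_mono (Ioo_subset_Ioo hs ht) le_rfl)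
  have h1 := integral_mul_norm_le_Lp_mul_Lq (μ := volume.restrict (Ioc s t)) (f := h)
    (g := fun _ => (1 : ℂ)) Real.HolderConjugate.two_two (by simpa using hh') (memLp_const _)
  simp only [norm_one, mul_one, Real.rpow_ofNat, one_pow, ← Real.sqrt_eq_rpow] at h1
  refine (norm_integral_le_integral_norm _).trans (h1.trans ?_)
  have h2 : ∫ _ in Ioc s t, (1 : ℝ) = t - s := by simp [hst]
  rw [h2]
  gcongr
  exact ae_of_all _ fun x => by positivity

/-- Integration by parts with `conj e_n = e_{-n}`, whose derivative is `-p_n e_{-n}`; the end values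
of the primitive supply the boundary terms. -/
theorem mul_integral_mul_conj_e {L : ℝ} {a b : ℝ} (hab : a ≤ b) (n : ℤ) {g h : ℝ → ℂ} {c : ℂ}
    (hh : IntegrableOn h (Ioo a b))
    (hg : ∀ᵐ x ∂(volume.restrict (Ioo a b)), g x = c + ∫ t in a..x, h t) :
    freq L n * ∫ x in a..b, g x * conj (e L n x)
      = e L (-n) a * c - e L (-n) b * (c + ∫ t in a..b, h t)
        + ∫ x in a..b, h x * conj (e L n x) := by
  have hcont := continuousOn_primitive_Ioo hab hh c
  have hcont0 := continuousOn_primitive_Ioo hab hh 0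
  simp only [zero_add] at hcont0
  have hce : Continuous fun x => freq L (-n) * e L (-n) x :=
    continuous_const.mul (continuous_e L (-n))
  have h1 := integral_deriv_mul_integral hab (hasDerivAt_e L (-n)) hce
    ((integrableOn_Ioc_iff_integrableOn_Ioo).2 hh)
  have h2 : ∫ x in a..b, freq L (-n) * e L (-n) x = e L (-n) b - e L (-n) a :=
    intervalIntegral.integral_eq_sub_of_hasDerivAt (fun x _ => hasDerivAt_e L (-n) x)
      (hce.intervalIntegrable _ _)
  have h3 : freq L n * ∫ x in a..b, g x * conj (e L n x)
      = -∫ x in a..b, (c * (freq L (-n) * e L (-n) x)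
          + (freq L (-n) * e L (-n) x) * ∫ t in a..x, h t) := by
    rw [← intervalIntegral.integral_const_mul, ← intervalIntegral.integral_neg,
      intervalIntegral.integral_of_le hab, intervalIntegral.integral_of_le hab,
      integral_Ioc_eq_integral_Ioo, integral_Ioc_eq_integral_Ioo]
    refine integral_congr_ae ?_
    filter_upwards [hg] with x hx
    rw [hx, conj_e, freq_neg]
    ring
  rw [h3, intervalIntegral.integral_add ((hce.intervalIntegrable _ _).const_mul c),
    intervalIntegral.integral_const_mul, h1, h2]
  · simp_rw [conj_e, mul_comm (h _)]
    ring
  · refine ContinuousOn.intervalIntegrable ?_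
    rw [uIcc_of_le hab]
    exact hce.continuousOn.mul hcont0

/-- These are the Fourier coefficients of `h` extended by zero to `(0, L)`. -/
theorem memlp_integral_mul_conj_e {L : ℝ} (hL : 0 < L) {a b : ℝ} (ha : 0 ≤ a) (hab : a ≤ b)
    (hb : b ≤ L) {h : ℝ → ℂ} (hh : MemLp h 2 (volume.restrict (Ioo a b))) :
    Memℓp (fun n => ∫ x in a..b, h x * conj (e L n x)) 2 := by
  have hs : Ioo a b ⊆ Ioc 0 L := (Ioo_subset_Ioo ha hb).trans Ioo_subset_Ioc_self
  have hm : MemLp ((Ioo a b).indicator h) 2 (vol L) := by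
    rw [memLp_indicator_iff_restrict measurableSet_Ioo, vol, Measure.restrict_restrict_of_subset hs]
    exact hh
  convert memlp_coeff hL (hm.toLp _) using 1
  ext n
  rw [coeff_congr hm.coeFn_toLp, intervalIntegral.integral_of_le hab, integral_Ioc_eq_integral_Ioo]
  have h1 : (fun x => (Ioo a b).indicator h x * conj (e L n x))
      = (Ioo a b).indicator fun x => h x * conj (e L n x) := by
    ext x; by_cases hx : x ∈ Ioo a b <;> simp [hx]
  rw [h1, setIntegral_indicator measurableSet_Ioo, inter_eq_right.2 hs]

theorem sum_intervalIntegral_fin {f : ℝ → ℂ} {d : ℕ} (σ : Fin (d + 2) → ℝ)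
    (hf : ∀ j : Fin (d + 1), IntervalIntegrable f volume (σ j.castSucc) (σ j.succ)) :
    ∑ j : Fin (d + 1), ∫ x in (σ j.castSucc)..(σ j.succ), f x
      = ∫ x in (σ 0)..(σ (Fin.last (d + 1))), f x := by
  let s : ℕ → ℝ := fun i => if h : i < d + 2 then σ ⟨i, h⟩ else 0
  have hs : ∀ j : Fin (d + 1), s j = σ j.castSucc ∧ s (j + 1) = σ j.succ := by
    intro j
    have h1 : (j : ℕ) < d + 2 := by omega
    have h2 : (j : ℕ) + 1 < d + 2 := by omega
    exact ⟨dif_pos h1, dif_pos h2⟩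
  have h := intervalIntegral.sum_integral_adjacent_intervals (μ := volume) (f := f) (a := s)
    (n := d + 1) (fun k hk => by
      have h1 := hs ⟨k, hk⟩
      simp only at h1
      rw [h1.1, h1.2]
      exact hf ⟨k, hk⟩)
  have h0 : s 0 = σ 0 := dif_pos (by omega)
  have hl : s (d + 1) = σ (Fin.last (d + 1)) := dif_pos (by omega)
  rw [← Fin.sum_univ_eq_sum_range (fun k => ∫ x in (s k)..(s (k + 1)), f x), h0, hl] at h
  rw [← h]
  exact Finset.sum_congr rfl fun j _ => by rw [(hs j).1, (hs j).2]

theorem IsPiecewiseSobolev.mem_Icc {L : ℝ} {m : ℕ} {f : L2 L} {d : ℕ} {σ : Fin (d + 2) → ℝ}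
    (h : IsPiecewiseSobolev m f d σ) (i : Fin (d + 2)) : 0 ≤ σ i ∧ σ i ≤ L :=
  ⟨h.2.1 ▸ h.1.monotone (Fin.zero_le i), h.2.2.1 ▸ h.1.monotone (Fin.le_last i)⟩

/-- Integration by parts on the pieces: `p_n^{k+1} f_n = -τ^f_n + ψ_n` with `ψ ∈ ℓ²`. -/
theorem exists_coeff_eq_neg_tau_add {L : ℝ} (hL : 0 < L) {k : ℕ} {f : L2 L}
    (hf : f ∈ sobolevPer L k) {d : ℕ} {σ : Fin (d + 2) → ℝ}
    (hσ : IsPiecewiseSobolev (k + 1) f d σ) :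
    ∃ ψ : ℤ → ℂ, Memℓp ψ 2 ∧
      ∀ n, freq L n ^ (k + 1) * coeff f n = -tau (k + 1) f d σ n + ψ n := by
  obtain ⟨g, hg⟩ := exists_periodic_deriv hL hf
  have hlt : ∀ j : Fin (d + 1), σ j.castSucc < σ j.succ := fun j => hσ.1 Fin.castSucc_lt_succ
  have hpiece := fun j : Fin (d + 1) => exists_primitive_on_piece hL hg
    (hσ.mem_Icc j.castSucc).1 (hlt j) (hσ.mem_Icc j.succ).2 (hσ.2.2.2 j)
  choose h hh hgh hl using hpiece
  refine ⟨fun n => ∑ j, ∫ x in (σ j.castSucc)..(σ j.succ), h j x * conj (e L n x), ?_, ?_⟩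
  · have := Memℓp.finsetSum (p := 2) Finset.univ
      (f := fun (j : Fin (d + 1)) n =>
        ∫ x in (σ j.castSucc)..(σ j.succ), h j x * conj (e L n x))
      fun j _ => memlp_integral_mul_conj_e hL (hσ.mem_Icc j.castSucc).1 (hlt j).le
        (hσ.mem_Icc j.succ).2 (hh j)
    exact this
  · intro n
    have hgi : ∀ a b, 0 ≤ a → a ≤ b → b ≤ L →
        IntervalIntegrable (fun x => g x * conj (e L n x)) volume a b := by
      intro a b ha hab hb
      rw [intervalIntegrable_iff_integrableOn_Ioo_of_le hab]
      simp_rw [mul_comm (g _)]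
      refine Integrable.bdd_mul (c := 1 / Real.sqrt L) (integrableOn_of_subset g ha hb)
        (by simp_rw [conj_e]; exact (continuous_e L (-n)).aestronglyMeasurable)
        (ae_of_all _ fun x => by rw [conj_e]; exact norm_e_le _ _)
    have h1 : coeff g n = ∑ j : Fin (d + 1), ∫ x in (σ j.castSucc)..(σ j.succ),
        g x * conj (e L n x) := by
      rw [sum_intervalIntegral_fin σ fun j => hgi _ _ (hσ.mem_Icc j.castSucc).1 (hlt j).le
        (hσ.mem_Icc j.succ).2, hσ.2.1, hσ.2.2.1, intervalIntegral.integral_of_le hL.le,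
        coeff_eq_integral]
    have h2 : ∀ j : Fin (d + 1), freq L n * ∫ x in (σ j.castSucc)..(σ j.succ),
        g x * conj (e L n x) = e L (-n) (σ j.castSucc) * rightValue k f (σ j.castSucc)
          - e L (-n) (σ j.succ) * leftValue k f (σ j.succ)
          + ∫ x in (σ j.castSucc)..(σ j.succ), h j x * conj (e L n x) := by
      intro j
      rw [mul_integral_mul_conj_e (hlt j).le n ((hh j).integrable (by norm_num)) (hgh j), hl j]
    have he0 : e L (-n) 0 = ((1 / Real.sqrt L : ℝ) : ℂ) := by simp [e]
    have heL : e L (-n) L = ((1 / Real.sqrt L : ℝ) : ℂ) := by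
      rw [e, exp_freq_mul_period hL, mul_one]
    rw [pow_succ', mul_assoc, ← hg, h1, Finset.mul_sum, Finset.sum_congr rfl fun j _ => h2 j,
      Finset.sum_add_distrib, Finset.sum_sub_distrib]
    congr 1
    -- The right value at `0` and the left value at `L` are split off; the remaining right and left
    -- values pair up at the interior points and form the jumps in `tau`.
    rw [Fin.sum_univ_succ, Fin.sum_univ_castSucc (fun j : Fin (d + 1) =>
      e L (-n) (σ j.succ) * leftValue k f (σ j.succ)), tau, Nat.add_sub_cancel, Fin.castSucc_zero,
      Fin.succ_last, hσ.2.1, hσ.2.2.1, he0, heL, mul_add, Finset.mul_sum]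
    have h3 : ∀ j : Fin d, ((1 / Real.sqrt L : ℝ) : ℂ) *
        (Complex.exp (-(freq L n * (σ j.succ.castSucc : ℂ))) *
        (leftValue k f (σ j.succ.castSucc) - rightValue k f (σ j.succ.castSucc)))
        = e L (-n) (σ j.castSucc.succ) * leftValue k f (σ j.castSucc.succ)
          - e L (-n) (σ j.succ.castSucc) * rightValue k f (σ j.succ.castSucc) := by
      intro j
      rw [Fin.succ_castSucc, e, freq_neg, neg_mul]
      ring
    rw [Finset.sum_congr rfl fun j _ => h3 j, Finset.sum_sub_distrib]
    ring

/-! ### Recurrence of trigonometric sums -/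

/-- Finitely many unit complex numbers have simultaneous large powers close to `1`. -/
theorem exists_pow_near_one {ι : Type*} [Fintype ι] (z : ι → ℂ) (hz : ∀ i, ‖z i‖ = 1)
    {ε : ℝ} (hε : 0 < ε) (N₀ : ℕ) : ∃ N ≥ N₀, ∀ i, ‖z i ^ N - 1‖ < ε := by
  have hb : ∀ k : ℕ, (fun i => z i ^ k) ∈ Metric.closedBall (0 : ι → ℂ) 1 := by
    intro k
    rw [mem_closedBall_zero_iff, pi_norm_le_iff_of_nonneg zero_le_one]
    intro i
    rw [norm_pow, hz, one_pow]
  -- The vectors of powers stay in a compact ball, so a subsequence is Cauchy, and the quotient of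
  -- two close powers is a power close to `1`. Comparing indices `k + N₀` and `k` makes the exponent
  -- at least `N₀`, as `θ` is strictly increasing.
  obtain ⟨y, -, θ, hθ, hy⟩ := (isCompact_closedBall (0 : ι → ℂ) 1).tendsto_subseq hb
  obtain ⟨k, hk⟩ := Metric.cauchySeq_iff.1 hy.cauchySeq ε hε
  have hle : θ k + N₀ ≤ θ (k + N₀) := by
    rw [add_comm k, add_comm (θ k)]
    exact hθ.add_le_nat N₀ k
  refine ⟨θ (k + N₀) - θ k, by omega, fun i => ?_⟩
  have h1 := hk (k + N₀) (by omega) k le_rfl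
  rw [dist_eq_norm] at h1
  have h2 := (norm_le_pi_norm _ i).trans_lt h1
  have h3 : z i ^ θ (k + N₀) - z i ^ θ k = z i ^ θ k * (z i ^ (θ (k + N₀) - θ k) - 1) := by
    rw [mul_sub, ← pow_add, mul_one]
    congr 2
    omega
  simp only [Pi.sub_apply, Function.comp_apply] at h2
  rwa [h3, norm_mul, norm_pow, hz, one_pow, one_mul] at h2

/-- The sequence `A + ∑ w_j exp(-p_n s_j)`. -/
noncomputable def trigSum (L : ℝ) {d : ℕ} (A : ℂ) (w : Fin d → ℂ) (s : Fin d → ℝ) (n : ℤ) : ℂ :=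
  A + ∑ j, Complex.exp (-(freq L n * (s j : ℂ))) * w j

theorem norm_exp_freq (L : ℝ) (n : ℤ) (x : ℝ) : ‖Complex.exp (-(freq L n * (x : ℂ)))‖ = 1 := by
  rw [Complex.norm_exp, Complex.neg_re, Complex.re_mul_ofReal, freq_re, zero_mul, neg_zero,
    Real.exp_zero]

/-- A shift by `N` multiplies each exponential by the `N`-th power of a fixed unit number, and these
powers can be made close to `1` simultaneously. -/
theorem trigSum_recurrent (L : ℝ) {d : ℕ} (A : ℂ) (w : Fin d → ℂ) (s : Fin d → ℝ) (n : ℤ)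
    {ε : ℝ} (hε : 0 < ε) (N₀ : ℕ) :
    ∃ N ≥ N₀, ‖trigSum L A w s (n + N) - trigSum L A w s n‖ < ε := by
  -- The summand `1` keeps the divisor nonzero when all weights vanish.
  have hW : 0 < 1 + ∑ j, ‖w j‖ := by positivity
  obtain ⟨N, hN, h⟩ := exists_pow_near_one (fun j => Complex.exp (-(freq L 1 * (s j : ℂ))))
    (fun j => norm_exp_freq L 1 (s j)) (div_pos hε hW) N₀
  refine ⟨N, hN, ?_⟩
  have h1 : trigSum L A w s (n + N) - trigSum L A w s n
      = ∑ j, Complex.exp (-(freq L n * (s j : ℂ))) *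
        (Complex.exp (-(freq L 1 * (s j : ℂ))) ^ N - 1) * w j := by
    rw [trigSum, trigSum, add_sub_add_left_eq_sub, ← Finset.sum_sub_distrib]
    refine Finset.sum_congr rfl fun j _ => ?_
    have h2 : -(freq L (n + N) * (s j : ℂ))
        = -(freq L n * (s j : ℂ)) + N * (-(freq L 1 * (s j : ℂ))) := by
      rw [freq_add, show freq L (N : ℤ) = N * freq L 1 by simp [freq]; ring]
      ring
    rw [h2, Complex.exp_add, Complex.exp_nat_mul]
    ring
  rw [h1]
  calc _ ≤ ∑ j, ε / (1 + ∑ j, ‖w j‖) * ‖w j‖ := by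
        refine norm_sum_le_of_le _ fun j _ => ?_
        rw [norm_mul, norm_mul, norm_exp_freq, one_mul]
        exact mul_le_mul_of_nonneg_right (h j).le (norm_nonneg _)
    _ = ε * ((∑ j, ‖w j‖) / (1 + ∑ j, ‖w j‖)) := by rw [← Finset.mul_sum]; ring
    _ < ε * 1 := by
        gcongr
        rw [div_lt_one hW]
        linarith
    _ = ε := mul_one ε

/-- Every value is approximated by values at arbitrarily large indices, so a bound near `+∞` holds
everywhere. -/
theorem trigSum_norm_ge {L : ℝ} {d : ℕ} {A : ℂ} {w : Fin d → ℂ} {s : Fin d → ℝ} {r : ℝ}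
    (h : ∀ᶠ n : ℤ in atTop, r ≤ ‖trigSum L A w s n‖) (n : ℤ) : r ≤ ‖trigSum L A w s n‖ := by
  obtain ⟨n₀, hn₀⟩ := eventually_atTop.1 h
  refine le_of_forall_pos_le_add fun ε hε => ?_
  obtain ⟨N, hN, hlt⟩ := trigSum_recurrent L A w s n hε (n₀ - n).toNat
  have h1 := hn₀ (n + N) (by omega)
  have h2 := norm_sub_norm_le (trigSum L A w s (n + N)) (trigSum L A w s n)
  linarith

theorem trigSum_eq_zero {L : ℝ} {d : ℕ} {A : ℂ} {w : Fin d → ℂ} {s : Fin d → ℝ}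
    (h : Tendsto (trigSum L A w s) atTop (𝓝 0)) (n : ℤ) : trigSum L A w s n = 0 := by
  rw [← norm_le_zero_iff]
  refine le_of_forall_pos_le_add fun ε hε => ?_
  have h1 := (tendsto_zero_iff_norm_tendsto_zero.1 h).eventually (gt_mem_nhds (half_pos hε))
  obtain ⟨n₀, hn₀⟩ := eventually_atTop.1 h1
  obtain ⟨N, hN, hlt⟩ := trigSum_recurrent L A w s n (half_pos hε) (n₀ - n).toNat
  have h1 := hn₀ (n + N) (by omega)
  have h2 := norm_sub_norm_le (trigSum L A w s n) (trigSum L A w s (n + N))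
  rw [norm_sub_rev] at h2
  linarith

/-! ### The numbers `τ^φ_n` -/

theorem tau_eq_trigSum {L : ℝ} (m : ℕ) (φ : L2 L) (d : ℕ) (σ : Fin (d + 2) → ℝ) :
    ∃ (A : ℂ) (w : Fin d → ℂ), ∀ n, tau m φ d σ n
      = trigSum L A w (fun j => σ j.succ.castSucc) n := by
  refine ⟨((1 / Real.sqrt L : ℝ) : ℂ) * (leftValue (m - 1) φ L - rightValue (m - 1) φ 0),
    fun j => ((1 / Real.sqrt L : ℝ) : ℂ) *
      (leftValue (m - 1) φ (σ j.succ.castSucc) - rightValue (m - 1) φ (σ j.succ.castSucc)),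
    fun n => ?_⟩
  rw [tau, trigSum, mul_add, Finset.mul_sum]
  congr 1
  exact Finset.sum_congr rfl fun j _ => by ring

theorem conj_coeff_of_real {L : ℝ} {φ : L2 L} (h : ∀ᵐ x ∂(vol L), (φ x).im = 0) (n : ℤ) :
    conj (coeff φ n) = coeff φ (-n) := by
  rw [coeff_eq_integral, coeff_eq_integral, ← integral_conj]
  refine integral_congr_ae ?_
  filter_upwards [h] with x hx
  rw [map_mul, conj_e, conj_e, neg_neg, Complex.conj_eq_iff_im.2 hx]

theorem tendsto_norm_freq {L : ℝ} (hL : 0 < L) : Tendsto (fun n : ℤ => ‖freq L n‖) atTop atTop := by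
  have h : ∀ᶠ n : ℤ in atTop, 2 * Real.pi / L * (n : ℝ) = ‖freq L n‖ := by
    filter_upwards [eventually_ge_atTop 0] with n hn
    rw [norm_freq hL, abs_of_nonneg (by exact_mod_cast hn)]
    ring
  refine Tendsto.congr' h (Tendsto.const_mul_atTop ?_ tendsto_intCast_atTop_atTop)
  have := Real.pi_pos
  positivity

section

variable {L : ℝ} {m : ℕ} {φ : L2 L} {d : ℕ} {σ : Fin (d + 2) → ℝ} {c : ℝ} {ψ : ℤ → ℂ}

/-- For large `n` the left side of `h` has modulus at least `c / 2` while `‖ψ n‖ < c / 4`;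
recurrence extends the resulting bound to all `n`. -/
theorem tau_bounded_below (hL : 0 < L) (hc : 0 < c)
    (hφ : ∀ n, c / Real.sqrt (weight L m n) ≤ ‖coeff φ n‖) (hψ : Memℓp ψ 2)
    (h : ∀ n, freq L n ^ m * coeff φ n = -tau m φ d σ n + ψ n) (n : ℤ) :
    c / 4 ≤ ‖tau m φ d σ n‖ := by
  obtain ⟨A, w, hA⟩ := tau_eq_trigSum m φ d σ
  rw [hA]
  refine trigSum_norm_ge ?_ n
  have hψ0 : Tendsto ψ atTop (𝓝 0) := by
    obtain ⟨f, hf⟩ := exists_coeff_eq hL hψ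
    rw [← show coeff f = ψ from funext hf]
    exact (tendsto_coeff_cofinite hL f).mono_left atTop_le_cofinite
  filter_upwards [(tendsto_norm_freq hL).eventually_ge_atTop 1,
    (tendsto_zero_iff_norm_tendsto_zero.1 hψ0).eventually (gt_mem_nhds (show 0 < c / 4 by linarith))]
    with k hk1 hk2
  rw [← hA]
  have h1 : c / 2 ≤ ‖freq L k ^ m * coeff φ k‖ := by
    have hP : 1 ≤ ‖freq L k‖ ^ m := one_le_pow₀ hk1
    -- For `|p_k| ≥ 1` the weight is at most `2 |p_k|^{2m}`, hence at most the square of the right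
    -- side.
    have hw : Real.sqrt (weight L m k) ≤ 2 * ‖freq L k‖ ^ m := by
      rw [Real.sqrt_le_left (by positivity), weight, mul_pow, ← pow_mul, mul_comm m 2]
      have : 1 ≤ ‖freq L k‖ ^ (2 * m) := one_le_pow₀ hk1
      linarith
    have hw0 := Real.sqrt_pos.2 (weight_pos L m k)
    rw [norm_mul, norm_pow]
    calc c / 2 = ‖freq L k‖ ^ m * (c / (2 * ‖freq L k‖ ^ m)) := by field_simp
      _ ≤ ‖freq L k‖ ^ m * (c / Real.sqrt (weight L m k)) := by gcongr
      _ ≤ _ := by have := hφ k; gcongr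
  have h2 : ‖freq L k ^ m * coeff φ k‖ ≤ ‖tau m φ d σ k‖ + ‖ψ k‖ := by
    rw [h]
    exact (norm_add_le _ _).trans (by rw [norm_neg])
  linarith

/-- Since `φ` is real, the two sides differ by `conj (ψ (-n)) - ψ n`, which tends to zero. The
difference is also a trigonometric sum, and a recurrent sequence tending to zero vanishes; the
reality of the one-sided values is never examined. -/
theorem conj_tau (hL : 0 < L) (hreal : ∀ᵐ x ∂(vol L), (φ x).im = 0) (hψ : Memℓp ψ 2)
    (h : ∀ n, freq L n ^ m * coeff φ n = -tau m φ d σ n + ψ n) (n : ℤ) :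
    conj (tau m φ d σ (-n)) = tau m φ d σ n := by
  obtain ⟨A, w, hA⟩ := tau_eq_trigSum m φ d σ
  have hs : ∀ n, conj (tau m φ d σ (-n)) - tau m φ d σ n
      = trigSum L (conj A - A) (fun j => conj (w j) - w j) (fun j => σ j.succ.castSucc) n := by
    intro n
    rw [hA, hA, trigSum, trigSum, trigSum, map_add, map_sum, add_sub_add_comm,
      ← Finset.sum_sub_distrib]
    congr 1
    refine Finset.sum_congr rfl fun j _ => ?_
    rw [map_mul, ← Complex.exp_conj, map_neg, map_mul, conj_freq, freq_neg, neg_neg,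
      Complex.conj_ofReal]
    ring
  have hδ : ∀ n, conj (tau m φ d σ (-n)) - tau m φ d σ n = conj (ψ (-n)) - ψ n := by
    intro n
    have h1 : ∀ k, tau m φ d σ k = ψ k - freq L k ^ m * coeff φ k := fun k => by rw [h]; ring
    rw [h1, h1, map_sub, map_mul, map_pow, conj_freq, conj_coeff_of_real hreal, freq_neg, neg_neg,
      neg_neg]
    ring
  have hψ0 : Tendsto ψ cofinite (𝓝 0) := by
    obtain ⟨f, hf⟩ := exists_coeff_eq hL hψ
    rw [← show coeff f = ψ from funext hf]
    exact tendsto_coeff_cofinite hL f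
  have hψ1 : Tendsto (fun n => conj (ψ (-n)) - ψ n) cofinite (𝓝 0) := by
    have h1 := (Complex.continuous_conj.tendsto 0).comp
      (hψ0.comp (neg_injective (G := ℤ)).tendsto_cofinite)
    simpa using h1.sub hψ0
  rw [← sub_eq_zero, hs]
  refine trigSum_eq_zero ?_ n
  refine (hψ1.mono_left atTop_le_cofinite).congr fun k => ?_
  rw [← hs, hδ]

/-- Over the common denominator the leading terms of `F` and `h` cancel, leaving only the `ℓ²`
remainder of the integration by parts. -/
theorem regularPart_eq (hreal : ∀ᵐ x ∂(vol L), (φ x).im = 0)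
    (hφ : ∀ n, coeff φ n ≠ 0) (hτ : ∀ n, tau m φ d σ n ≠ 0)
    (h : ∀ n, freq L n ^ m * coeff φ n = -tau m φ d σ n + ψ n) (lam : ℝ) (n : ℤ) :
    regularPart m lam φ d σ n
      = -(K L lam : ℂ) * ψ (-n) / (tau m φ d σ (-n) * coeff φ (-n)) := by
  have h1 : ψ (-n) = (-1) ^ m * freq L n ^ m * coeff φ (-n) + tau m φ d σ (-n) := by
    rw [← neg_pow, ← freq_neg, h]; ring
  have h2 := hφ (-n)
  have h3 := hτ (-n)
  rw [regularPart, Pi.sub_apply, F, singularPart, conj_coeff_of_real hreal, h1]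
  field_simp
  ring

/-- Dividing by `φ` costs `√weight`, which the coefficients of `α` absorb; what remains is a product
of two `ℓ²` sequences. -/
theorem summable_regularPart (hc : 0 < c)
    (hφ : ∀ n, c / Real.sqrt (weight L m n) ≤ ‖coeff φ n‖) {r : ℝ} (hr : 0 < r)
    (hτ : ∀ n, r ≤ ‖tau m φ d σ n‖) (hψ : Memℓp ψ 2) {lam : ℝ}
    (h : ∀ n, regularPart m lam φ d σ n
      = -(K L lam : ℂ) * ψ (-n) / (tau m φ d σ (-n) * coeff φ (-n))) (α : HPer L m) :
    Summable fun n : ℤ => coeff α.toL2 n * conj (regularPart m lam φ d σ n) := by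
  have hψ' : Summable fun n : ℤ => ‖ψ (-n)‖ ^ 2 :=
    (memlp_two_iff.1 hψ).comp_injective neg_injective
  refine Summable.of_norm_bounded ((α.summable.add hψ').mul_left (|K L lam| / (r * c))) fun n => ?_
  set W := Real.sqrt (weight L m n) with hW
  have hW0 : 0 < W := Real.sqrt_pos.2 (weight_pos L m n)
  have hWsq : W ^ 2 = weight L m n := Real.sq_sqrt (weight_pos L m n).le
  have h1 : ‖regularPart m lam φ d σ n‖ ≤ |K L lam| / (r * c) * (W * ‖ψ (-n)‖) := by
    have hφn := hφ (-n)
    rw [weight_neg, ← hW] at hφn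
    have hτn := hτ (-n)
    rw [h, norm_div, norm_mul, norm_mul, norm_neg, Complex.norm_real, Real.norm_eq_abs]
    calc |K L lam| * ‖ψ (-n)‖ / (‖tau m φ d σ (-n)‖ * ‖coeff φ (-n)‖)
        ≤ |K L lam| * ‖ψ (-n)‖ / (r * (c / W)) := by gcongr
      _ = _ := by field_simp
  rw [norm_mul, RCLike.norm_conj, ← hWsq]
  calc ‖coeff α.toL2 n‖ * ‖regularPart m lam φ d σ n‖
      ≤ ‖coeff α.toL2 n‖ * (|K L lam| / (r * c) * (W * ‖ψ (-n)‖)) := by gcongr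
    _ = |K L lam| / (r * c) * ((W * ‖coeff α.toL2 n‖) * ‖ψ (-n)‖) := by ring
    _ ≤ |K L lam| / (r * c) * (W ^ 2 * ‖coeff α.toL2 n‖ ^ 2 + ‖ψ (-n)‖ ^ 2) := by
        gcongr
        nlinarith [sq_nonneg (W * ‖coeff α.toL2 n‖ - ‖ψ (-n)‖),
          sq_nonneg (W * ‖coeff α.toL2 n‖), sq_nonneg ‖ψ (-n)‖]

end

/-! ### Symmetric partial sums of Fourier coefficients -/

theorem Icc_neg_succ (N : ℕ) : Finset.Icc (-((N + 1 : ℕ) : ℤ)) ((N + 1 : ℕ) : ℤ)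
    = insert (-((N : ℤ) + 1)) (insert ((N : ℤ) + 1) (Finset.Icc (-(N : ℤ)) N)) := by
  ext k
  simp only [Finset.mem_Icc, Finset.mem_insert]
  omega

theorem sum_Icc_neg_succ (a : ℤ → ℂ) (N : ℕ) :
    ∑ n ∈ Finset.Icc (-((N + 1 : ℕ) : ℤ)) ((N + 1 : ℕ) : ℤ), a n
      = a (-((N : ℤ) + 1)) + (a ((N : ℤ) + 1) + ∑ n ∈ Finset.Icc (-(N : ℤ)) N, a n) := by
  rw [Icc_neg_succ, Finset.sum_insert, Finset.sum_insert]
  · simp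
  · simp only [Finset.mem_insert, Finset.mem_Icc]
    omega

theorem sum_Icc_neg_telescope (Q : ℤ → ℂ) (N : ℕ) :
    ∑ n ∈ Finset.Icc (-(N : ℤ)) N, (Q (n - 1) - Q n) = Q (-(N : ℤ) - 1) - Q N := by
  induction N with
  | zero => simp
  | succ N ih =>
    rw [sum_Icc_neg_succ, ih]
    push_cast
    ring_nf

theorem sum_Icc_neg_comp_neg (a : ℤ → ℂ) (N : ℕ) :
    ∑ n ∈ Finset.Icc (-(N : ℤ)) N, a (-n) = ∑ n ∈ Finset.Icc (-(N : ℤ)) N, a n :=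
  Finset.sum_nbij' (fun n => -n) (fun n => -n) (by simp; omega) (by simp; omega) (by simp)
    (by simp) (by simp)

theorem tendsto_sum_Icc_neg {a : ℤ → ℂ} {s : ℂ} (h : HasSum a s) :
    Tendsto (fun N : ℕ => ∑ n ∈ Finset.Icc (-(N : ℤ)) N, a n) atTop (𝓝 s) := by
  have h1 : Tendsto (fun N : ℕ => Finset.Icc (-(N : ℤ)) N) atTop atTop :=
    tendsto_atTop_finset_of_monotone
      (fun M N hMN => Finset.Icc_subset_Icc (by simpa using hMN) (by simpa using hMN))
      (fun k => ⟨k.natAbs, by rw [Finset.mem_Icc]; omega⟩)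
  have h2 : Tendsto (fun t : Finset ℤ => ∑ n ∈ t, a n) atTop (𝓝 s) := by
    simpa only [HasSum, SummationFilter.unconditional_filter] using h
  exact h2.comp h1

/-- The Riemann-Lebesgue lemma on `(0, L]`. -/
theorem tendsto_integral_mul_conj_e {L : ℝ} (hL : 0 < L) (q : ℝ → ℂ) :
    Tendsto (fun n : ℤ => ∫ x in Ioc 0 L, q x * conj (e L n x)) cofinite (𝓝 0) := by
  have hc : Tendsto (fun n : ℤ => (n : ℝ) / L) cofinite (cocompact ℝ) := by
    have h1 : Tendsto (fun n : ℤ => (n : ℝ)) cofinite (cocompact ℝ) :=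
      Int.tendsto_coe_cofinite
    have h2 : Tendsto (fun x : ℝ => x / L) (cocompact ℝ) (cocompact ℝ) :=
      (Homeomorph.mulRight₀ L⁻¹ (inv_ne_zero hL.ne')).isClosedEmbedding.tendsto_cocompact
    exact h2.comp h1
  have h := ((Real.tendsto_integral_exp_smul_cocompact ((Ioc 0 L).indicator q)).comp hc).const_mul
    ((1 / Real.sqrt L : ℝ) : ℂ)
  rw [mul_zero] at h
  refine h.congr fun n => ?_
  simp only [Function.comp_apply]
  rw [← integral_indicator measurableSet_Ioc, ← integral_const_mul]
  refine integral_congr_ae (ae_of_all _ fun x => ?_)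
  by_cases hx : x ∈ Ioc 0 L
  · simp only [indicator_of_mem hx]
    rw [conj_e, e, Circle.smul_def, Real.fourierChar_apply, smul_eq_mul, freq_neg, freq]
    have hL' : (L : ℂ) ≠ 0 := by exact_mod_cast hL.ne'
    have h3 : ((2 * Real.pi * -(x * (n / L)) : ℝ) : ℂ) * Complex.I
        = -(2 * Complex.I * Real.pi * n / L) * x := by
      push_cast; field_simp
    rw [h3]
    ring
  · simp [indicator_of_notMem hx]

/-- The modulus is `2 |sin (πx/L)|`; Jordan's inequality applies on the left half, and on the right
half after reflection. -/
theorem norm_exp_freq_one_sub_one {L : ℝ} (hL : 0 < L) {x : ℝ} (hx : x ∈ Icc 0 L) :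
    4 / L * min x (L - x) ≤ ‖Complex.exp (freq L 1 * x) - 1‖ := by
  have hπ := Real.pi_pos
  have h1 : freq L 1 * x = Complex.I * ((2 * Real.pi * x / L : ℝ) : ℂ) := by
    rw [freq]; push_cast; ring
  have hy : 2 * Real.pi * x / L / 2 = Real.pi * (x / L) := by ring
  rw [h1, Complex.norm_exp_I_mul_ofReal_sub_one, hy]
  have hs : 2 / L * min x (L - x) ≤ Real.sin (Real.pi * (x / L)) := by
    rcases le_total x (L - x) with hx2 | hx2
    · rw [min_eq_left hx2]
      have h2 := Real.mul_le_sin (x := Real.pi * (x / L))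
        (mul_nonneg hπ.le (div_nonneg hx.1 hL.le)) (by
          rw [div_eq_mul_inv Real.pi 2]
          gcongr
          rw [div_le_iff₀ hL]; linarith)
      refine le_trans (le_of_eq ?_) h2
      field_simp
    · rw [min_eq_right hx2, ← Real.sin_pi_sub]
      have h3 : Real.pi - Real.pi * (x / L) = Real.pi * ((L - x) / L) := by field_simp
      rw [h3]
      have h2 := Real.mul_le_sin (x := Real.pi * ((L - x) / L))
        (mul_nonneg hπ.le (div_nonneg (by linarith [hx.2]) hL.le)) (by
          rw [div_eq_mul_inv Real.pi 2]
          gcongr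
          rw [div_le_iff₀ hL]; linarith)
      refine le_trans (le_of_eq ?_) h2
      field_simp
  have h4 : 4 / L * min x (L - x) = 2 * (2 / L * min x (L - x)) := by ring
  rw [Real.norm_eq_abs, h4]
  refine le_trans ?_ (le_abs_self _)
  linarith

theorem integrableOn_inv_sqrt (L : ℝ) : IntegrableOn (fun x : ℝ => (Real.sqrt x)⁻¹) (Ioc 0 L) := by
  rcases le_or_gt L 0 with hL | hL
  · rw [Ioc_eq_empty (not_lt.2 hL)]; exact integrableOn_empty
  · have h := (intervalIntegral.intervalIntegrable_rpow' (a := 0) (b := L)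
      (show (-1 : ℝ) < -(1 / 2) by norm_num)).1
    refine h.congr_fun (fun x hx => ?_) measurableSet_Ioc
    simp only
    rw [Real.rpow_neg hx.1.le, Real.sqrt_eq_rpow]

theorem integrableOn_inv_sqrt_sub (L : ℝ) :
    IntegrableOn (fun x : ℝ => (Real.sqrt (L - x))⁻¹) (Ioo 0 L) := by
  have h1 : IntegrableOn (fun x : ℝ => (Real.sqrt x)⁻¹) (Ioo 0 L) :=
    (integrableOn_inv_sqrt L).mono_set Ioo_subset_Ioc_self
  have hmp : MeasurePreserving (fun x : ℝ => L - x) volume volume :=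
    Measure.measurePreserving_sub_left volume L
  have h2 := (hmp.integrableOn_comp_preimage (MeasurableEquiv.subLeft L).measurableEmbedding).2 h1
  have h3 : (fun x : ℝ => L - x) ⁻¹' Ioo 0 L = Ioo 0 L := by
    ext x; simp only [mem_preimage, mem_Ioo]; constructor <;> intro h <;> constructor <;> linarith
  rwa [h3] at h2

/-- A function which is Hölder-`1/2` at both ends of `(0, L)`, divided by `e^{2πix/L} - 1`, is
integrable. -/
theorem integrableOn_div_exp_sub_one {L : ℝ} (hL : 0 < L) {r : ℝ → ℂ} (hr : IntegrableOn r (Ioo 0 L))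
    {δ M : ℝ} (hδ : 0 < δ) (hM : 0 ≤ M)
    (h0 : ∀ᵐ x ∂(volume.restrict (Ioo 0 L)), x < δ → ‖r x‖ ≤ M * Real.sqrt x)
    (h1 : ∀ᵐ x ∂(volume.restrict (Ioo 0 L)), L - x < δ → ‖r x‖ ≤ M * Real.sqrt (L - x)) :
    IntegrableOn (fun x => r x / (Complex.exp (freq L 1 * x) - 1)) (Ioo 0 L) := by
  set κ := L / 4 with hκ
  have hκ0 : 0 < κ := by positivity
  have hbd : IntegrableOn (fun x => κ * M * (Real.sqrt x)⁻¹ + κ * M * (Real.sqrt (L - x))⁻¹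
      + κ / δ * ‖r x‖) (Ioo 0 L) :=
    ((((integrableOn_inv_sqrt L).mono_set Ioo_subset_Ioc_self).const_mul _).add
      ((integrableOn_inv_sqrt_sub L).const_mul _)).add (hr.norm.const_mul _)
  refine Integrable.mono' hbd ?_ ?_
  · refine hr.aestronglyMeasurable.div₀ ?_
    exact (by fun_prop : Continuous fun x : ℝ => Complex.exp (freq L 1 * x) - 1).aestronglyMeasurable
  · filter_upwards [h0, h1, ae_restrict_mem measurableSet_Ioo] with x hx0 hx1 hx
    have hlow := norm_exp_freq_one_sub_one hL (Ioo_subset_Icc_self hx)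
    have hx2 : 0 < L - x := sub_pos.2 hx.2
    have hmin : 0 < min x (L - x) := lt_min hx.1 hx2
    have hden : 0 < 4 / L * min x (L - x) := by positivity
    have hdiv : ‖r x / (Complex.exp (freq L 1 * x) - 1)‖ ≤ κ * (‖r x‖ / min x (L - x)) := by
      rw [norm_div]
      calc _ ≤ ‖r x‖ / (4 / L * min x (L - x)) := by gcongr
        _ = _ := by rw [hκ]; field_simp
    have hn1 : 0 ≤ κ * M * (Real.sqrt x)⁻¹ := by positivity
    have hn2 : 0 ≤ κ * M * (Real.sqrt (L - x))⁻¹ := by positivity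
    have hn3 : 0 ≤ κ / δ * ‖r x‖ := by positivity
    refine hdiv.trans ?_
    -- Away from the ends the denominator is bounded below; near an end the Hölder bound leaves an
    -- inverse square root, which is integrable.
    rcases le_or_gt δ (min x (L - x)) with hc | hc
    · have : κ * (‖r x‖ / min x (L - x)) ≤ κ * (‖r x‖ / δ) := by gcongr
      have h2 : κ * (‖r x‖ / δ) = κ / δ * ‖r x‖ := by ring
      linarith
    · rcases le_total x (L - x) with hc2 | hc2
      · rw [min_eq_left hc2] at hc ⊢
        have h3 : κ * (‖r x‖ / x) ≤ κ * (M * Real.sqrt x / x) := by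
          have := hx0 hc
          have := hx.1
          gcongr
        have h4 : κ * (M * Real.sqrt x / x) = κ * M * (Real.sqrt x)⁻¹ := by
          rw [mul_div_assoc, Real.sqrt_div_self', ← mul_assoc, one_div]
        linarith
      · rw [min_eq_right hc2] at hc ⊢
        have h3 : κ * (‖r x‖ / (L - x)) ≤ κ * (M * Real.sqrt (L - x) / (L - x)) := by
          have := hx1 hc
          gcongr
        have h4 : κ * (M * Real.sqrt (L - x) / (L - x)) = κ * M * (Real.sqrt (L - x))⁻¹ := by
          rw [mul_div_assoc, Real.sqrt_div_self', ← mul_assoc, one_div]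
        linarith

theorem integral_conj_e {L : ℝ} (hL : 0 < L) (n : ℤ) :
    ∫ x in Ioc 0 L, conj (e L n x) = if n = 0 then (Real.sqrt L : ℂ) else 0 := by
  have hs : ((Real.sqrt L : ℝ) : ℂ) ≠ 0 := by exact_mod_cast (Real.sqrt_pos.2 hL).ne'
  have h1 : ∀ x, conj (e L n x) = Real.sqrt L * (e L 0 x * conj (e L n x)) := by
    intro x
    have : e L 0 x = 1 / (Real.sqrt L : ℂ) := by rw [e, freq_zero]; simp
    rw [this]
    field_simp
  rw [integral_congr_ae (ae_of_all _ h1), integral_const_mul, ← coeff_congr (coeFn_ofContinuous L _ (continuous_e L 0)), ← eL2,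
    coeff_eL2 hL]
  split_ifs <;> simp

/-- Reflection `x ↦ L - x` exchanges the coefficients at `n` and `-n`, and the affine function plus
its reflection is the constant `A + B`. -/
theorem coeff_affine_add_coeff_neg {L : ℝ} (hL : 0 < L) (A B : ℂ)
    (hc : Continuous fun x : ℝ => A + (B - A) * (x / L)) (n : ℤ) :
    coeff (ofContinuous L _ hc) n + coeff (ofContinuous L _ hc) (-n)
      = if n = 0 then (A + B) * Real.sqrt L else 0 := by
  have hL' : (L : ℂ) ≠ 0 := by exact_mod_cast hL.ne'
  have hcont : ∀ k, Continuous fun x : ℝ => (A + (B - A) * (x / L)) * conj (e L k x) := fun k => by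
    simp_rw [conj_e]; exact hc.mul (continuous_e L _)
  have h1 : coeff (ofContinuous L _ hc) (-n)
      = ∫ x in (0 : ℝ)..L, (A + (B - A) * ((L - x : ℝ) / L)) * conj (e L n x) := by
    have h := intervalIntegral.integral_comp_sub_left (a := 0) (b := L)
      (fun x : ℝ => (A + (B - A) * (x / L)) * conj (e L (-n) x)) L
    rw [sub_self, sub_zero] at h
    rw [coeff_congr (coeFn_ofContinuous L _ hc), ← intervalIntegral.integral_of_le hL.le, ← h]
    refine intervalIntegral.integral_congr fun x _ => ?_
    have h2 : e L n (L - x) = e L (-n) x := by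
      rw [e, e, freq_neg, Complex.ofReal_sub, mul_sub, Complex.exp_sub, exp_freq_mul_period hL,
        neg_mul, Complex.exp_neg, one_div (Complex.exp _)]
    simp only [conj_e, neg_neg, h2]
  rw [h1, coeff_congr (coeFn_ofContinuous L _ hc), ← intervalIntegral.integral_of_le hL.le,
    ← intervalIntegral.integral_add ((hcont n).intervalIntegrable _ _)]
  · have h3 : ∀ x : ℝ, (A + (B - A) * (x / L)) * conj (e L n x)
        + (A + (B - A) * ((L - x : ℝ) / L)) * conj (e L n x) = (A + B) * conj (e L n x) := by
      intro x
      push_cast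
      field_simp
      ring
    simp_rw [h3]
    rw [intervalIntegral.integral_const_mul, intervalIntegral.integral_of_le hL.le,
      integral_conj_e hL, mul_ite, mul_zero]
  · refine Continuous.intervalIntegrable ?_ _ _
    simp_rw [conj_e]
    exact Continuous.mul (by fun_prop) (continuous_e L _)

theorem sum_coeff_affine {L : ℝ} (hL : 0 < L) (A B : ℂ)
    (hc : Continuous fun x : ℝ => A + (B - A) * (x / L)) (N : ℕ) :
    ∑ n ∈ Finset.Icc (-(N : ℤ)) N, coeff (ofContinuous L _ hc) n
      = Real.sqrt L * (A + B) / 2 := by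
  have h := Finset.sum_congr (rfl : Finset.Icc (-(N : ℤ)) N = _)
    fun n _ => coeff_affine_add_coeff_neg hL A B hc n
  rw [Finset.sum_add_distrib, sum_Icc_neg_comp_neg, Finset.sum_ite_eq' _ 0, if_pos (by simp)] at h
  linear_combination h / 2

/-- Convergence of the symmetric partial sums of the Fourier series at the end point of `(0, L)`,
for a function which is Hölder-`1/2` at both ends. -/
theorem tendsto_sum_coeff {L : ℝ} (hL : 0 < L) (f : L2 L) {A B : ℂ} {δ M : ℝ} (hδ : 0 < δ)
    (hM : 0 ≤ M)
    (h0 : ∀ᵐ x ∂(volume.restrict (Ioo 0 L)), x < δ → ‖f x - A‖ ≤ M * Real.sqrt x)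
    (h1 : ∀ᵐ x ∂(volume.restrict (Ioo 0 L)), L - x < δ → ‖f x - B‖ ≤ M * Real.sqrt (L - x)) :
    Tendsto (fun N : ℕ => ∑ n ∈ Finset.Icc (-(N : ℤ)) N, coeff f n) atTop
      (𝓝 (Real.sqrt L * (A + B) / 2)) := by
  have hL' : (L : ℂ) ≠ 0 := by exact_mod_cast hL.ne'
  have hc : Continuous fun x : ℝ => A + (B - A) * (x / L) := by fun_prop
  set r : ℝ → ℂ := fun x => f x - (A + (B - A) * (x / L)) with hr
  have hfi : IntegrableOn f (Ioo 0 L) := integrableOn_of_subset f le_rfl le_rfl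
  have hri : IntegrableOn r (Ioo 0 L) :=
    hfi.sub (hc.integrableOn_Icc.mono_set Ioo_subset_Icc_self)
  set M' := M + ‖B - A‖ / Real.sqrt L with hM'
  -- The affine correction is itself Hölder-`1/2` at the ends because `x / L ≤ √(x / L)`.
  have hlin : ∀ x, 0 ≤ x → x ≤ L → ‖(B - A) * ((x : ℂ) / L)‖
      ≤ ‖B - A‖ / Real.sqrt L * Real.sqrt x := by
    intro x hx hxL
    rw [norm_mul, norm_div, Complex.norm_real, Complex.norm_real, Real.norm_of_nonneg hx,
      Real.norm_of_nonneg hL.le, div_mul_eq_mul_div, mul_div_assoc]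
    refine mul_le_mul_of_nonneg_left ?_ (norm_nonneg _)
    rw [← Real.sqrt_div' x hL.le]
    apply Real.le_sqrt_of_sq_le
    have h2 : x / L ≤ 1 := (div_le_one hL).2 hxL
    have h3 : 0 ≤ x / L := by positivity
    nlinarith
  have hq := integrableOn_div_exp_sub_one hL hri hδ (M := M') (by positivity) (by
    filter_upwards [h0, ae_restrict_mem measurableSet_Ioo] with x hx hx' hxδ
    have h2 : r x = (f x - A) - (B - A) * (x / L) := by rw [hr]; ring
    rw [h2, hM', add_mul]
    exact (norm_sub_le _ _).trans (add_le_add (hx hxδ) (hlin x hx'.1.le hx'.2.le))) (by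
    filter_upwards [h1, ae_restrict_mem measurableSet_Ioo] with x hx hx' hxδ
    have h2 : r x = (f x - B) + (B - A) * ((L - x : ℝ) / L) := by
      rw [hr]; push_cast; field_simp; ring
    rw [h2, hM', add_mul]
    exact (norm_add_le _ _).trans (add_le_add (hx hxδ)
      (hlin (L - x) (by linarith [hx'.2]) (by linarith [hx'.1]))))
  set q : ℝ → ℂ := fun x => r x / (Complex.exp (freq L 1 * x) - 1) with hqdef
  set Q : ℤ → ℂ := fun n => ∫ x in Ioc 0 L, q x * conj (e L n x) with hQ
  have hqe : ∀ n, IntegrableOn (fun x => q x * conj (e L n x)) (Ioo 0 L) := by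
    intro n
    simp_rw [mul_comm (q _)]
    refine Integrable.bdd_mul (c := 1 / Real.sqrt L) hq
        (by simp_rw [conj_e]; exact (continuous_e L (-n)).aestronglyMeasurable)
        (ae_of_all _ fun x => by rw [conj_e]; exact norm_e_le _ _)
  -- Writing the remainder as `(e^{p_1 x} - 1) q` turns its coefficients into differences of those
  -- of `q`. Symmetric sums then telescope to two terms killed by Riemann–Lebesgue, and the affine
  -- part contributes the mean value.
  have hcoeff : ∀ n, coeff f n = (Q (n - 1) - Q n) + coeff (ofContinuous L _ hc) n := by
    intro n
    have h2 : coeff f n - coeff (ofContinuous L _ hc) n = ∫ x in Ioo 0 L, r x * conj (e L n x) := by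
      rw [sub_eq_add_neg, ← neg_one_mul, ← coeff_smul, ← coeff_add, neg_one_smul, ← sub_eq_add_neg,
        ← integral_Ioc_eq_integral_Ioo]
      refine coeff_congr ?_ n
      filter_upwards [Lp.coeFn_sub f (ofContinuous L _ hc), coeFn_ofContinuous L _ hc] with x hx hx'
      rw [hx, Pi.sub_apply, hx']
    rw [← sub_eq_iff_eq_add, h2, hQ]
    simp only
    rw [integral_Ioc_eq_integral_Ioo, integral_Ioc_eq_integral_Ioo, ← integral_sub (hqe _) (hqe _)]
    refine setIntegral_congr_fun measurableSet_Ioo fun x hx => ?_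
    have hne : Complex.exp (freq L 1 * x) - 1 ≠ 0 := by
      rw [← norm_pos_iff]
      refine lt_of_lt_of_le ?_ (norm_exp_freq_one_sub_one hL (Ioo_subset_Icc_self hx))
      have := lt_min hx.1 (sub_pos.2 hx.2)
      positivity
    have h3 : conj (e L (n - 1) x) = Complex.exp (freq L 1 * x) * conj (e L n x) := by
      rw [conj_e, conj_e, e, e, mul_left_comm, ← Complex.exp_add, freq_neg, freq_neg, freq_sub]
      ring_nf
    simp only [hqdef, h3]
    field_simp
  have hQ0 : Tendsto Q cofinite (𝓝 0) := tendsto_integral_mul_conj_e hL q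
  have hQ1 : Tendsto (fun N : ℕ => Q (-(N : ℤ) - 1)) atTop (𝓝 0) := by
    rw [← Nat.cofinite_eq_atTop]
    exact hQ0.comp (Function.Injective.tendsto_cofinite fun a b h => by simpa using h)
  have hQ2 : Tendsto (fun N : ℕ => Q N) atTop (𝓝 0) := by
    rw [← Nat.cofinite_eq_atTop]
    exact hQ0.comp (Function.Injective.tendsto_cofinite fun a b h => by simpa using h)
  have h3 := (hQ1.sub hQ2).add_const ((Real.sqrt L : ℂ) * (A + B) / 2)
  rw [sub_zero, zero_add] at h3
  refine h3.congr fun N => ?_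
  simp_rw [hcoeff]
  rw [Finset.sum_add_distrib, sum_Icc_neg_telescope, sum_coeff_affine hL]

/-- The same, for a function which is an indefinite integral of an `L²` function near both ends. -/
theorem tendsto_sum_coeff_of_primitive {L : ℝ} (hL : 0 < L) (f : L2 L) {a b : ℝ} (ha : a < L)
    (hb : 0 < b) {A A' : ℂ} {h h' : ℝ → ℂ}
    (hh : MemLp h 2 (volume.restrict (Ioo 0 b))) (hh' : MemLp h' 2 (volume.restrict (Ioo a L)))
    (hf : ∀ᵐ x ∂(volume.restrict (Ioo 0 b)), f x = A + ∫ t in (0 : ℝ)..x, h t)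
    (hf' : ∀ᵐ x ∂(volume.restrict (Ioo a L)), f x = A' + ∫ t in a..x, h' t) :
    Tendsto (fun N : ℕ => ∑ n ∈ Finset.Icc (-(N : ℤ)) N, coeff f n) atTop
      (𝓝 (Real.sqrt L * (A + (A' + ∫ t in a..L, h' t)) / 2)) := by
  obtain ⟨M, hM, hMb⟩ := norm_integral_le_sqrt hh
  obtain ⟨M', hM', hMb'⟩ := norm_integral_le_sqrt hh'
  rw [ae_restrict_iff' measurableSet_Ioo] at hf hf'
  refine tendsto_sum_coeff hL f (δ := min b (L - a)) (M := max M M')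
    (lt_min hb (sub_pos.2 ha)) (hM.trans (le_max_left _ _)) ?_ ?_
  · filter_upwards [ae_restrict_of_ae hf, ae_restrict_mem measurableSet_Ioo] with x hx hx' hxδ
    have hxb := hxδ.trans_le (min_le_left _ _)
    rw [hx ⟨hx'.1, hxb⟩, add_sub_cancel_left]
    have := hMb 0 x le_rfl hx'.1.le hxb.le
    rw [sub_zero] at this
    exact this.trans (mul_le_mul_of_nonneg_right (le_max_left _ _) (Real.sqrt_nonneg _))
  · filter_upwards [ae_restrict_of_ae hf', ae_restrict_mem measurableSet_Ioo] with x hx hx' hxδ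
    have hxa : a < x := by
      have := hxδ.trans_le (min_le_right _ _)
      linarith
    have hi : IntegrableOn h' (Ioo a L) := hh'.integrable (by norm_num)
    have hi1 : IntervalIntegrable h' volume a x :=
      (intervalIntegrable_iff_integrableOn_Ioo_of_le hxa.le).2
        (hi.mono_set (Ioo_subset_Ioo le_rfl hx'.2.le))
    have hi2 : IntervalIntegrable h' volume x L :=
      (intervalIntegrable_iff_integrableOn_Ioo_of_le hx'.2.le).2
        (hi.mono_set (Ioo_subset_Ioo hxa.le le_rfl))
    rw [hx ⟨hxa, hx'.2⟩, ← intervalIntegral.integral_add_adjacent_intervals hi1 hi2,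
      add_sub_add_left_eq_sub, sub_add_cancel_left, norm_neg]
    exact (hMb' x L hxa.le hx'.2.le le_rfl).trans
      (mul_le_mul_of_nonneg_right (le_max_right _ _) (Real.sqrt_nonneg _))

/-! ### The feedback law as a limit of symmetric partial sums -/

/-- Piecewise regularity alone does not make `p_n^m β_n` square summable; dividing by `τ`, which is
bounded below, transfers the periodic regularity of `α` to `β`. -/
theorem mem_sobolevPer_of_isTauImage {L : ℝ} {m : ℕ} {φ α β : L2 L} {d : ℕ}
    {σ : Fin (d + 2) → ℝ} {r : ℝ} (hr : 0 < r) (hτ : ∀ n, r ≤ ‖tau m φ d σ n‖)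
    (hα : α ∈ sobolevPer L m) (h : IsTauImage m φ d σ β α) : β ∈ sobolevPer L m := by
  rw [mem_sobolevPer_iff] at hα ⊢
  refine Summable.of_nonneg_of_le
    (fun n => mul_nonneg (weight_pos L m n).le (by positivity)) (fun n => ?_)
    (hα.mul_left (1 / r ^ 2))
  have h1 : r ^ 2 * ‖coeff β n‖ ^ 2 ≤ ‖coeff α n‖ ^ 2 := by
    rw [h n, norm_mul, mul_pow]
    have := hτ n
    gcongr
  have hw := weight_pos L m n
  calc weight L m n * ‖coeff β n‖ ^ 2
      = 1 / r ^ 2 * (weight L m n * (r ^ 2 * ‖coeff β n‖ ^ 2)) := by field_simp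
    _ ≤ _ := by gcongr

/-- Only the first and last pieces matter: interior jumps do not affect convergence at the end
point. -/
theorem tendsto_sum_coeff_deriv {L : ℝ} (hL : 0 < L) {m : ℕ} {β g : L2 L}
    (hg : ∀ n, coeff g n = freq L n ^ m * coeff β n) (hβ : MemPiecewiseSobolev (m + 1) β) :
    Tendsto (fun N : ℕ => ∑ n ∈ Finset.Icc (-(N : ℤ)) N, coeff g n) atTop
      (𝓝 (Real.sqrt L * (rightValue m β 0 + leftValue m β L) / 2)) := by
  obtain ⟨d, σ, hσ⟩ := hβ
  have hlt : ∀ j : Fin (d + 1), σ j.castSucc < σ j.succ := fun j => hσ.1 Fin.castSucc_lt_succ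
  obtain ⟨h, hh, hf, -⟩ := exists_primitive_on_piece hL hg (hσ.mem_Icc _).1 (hlt 0)
    (hσ.mem_Icc _).2 (hσ.2.2.2 0)
  obtain ⟨h', hh', hf', hl'⟩ := exists_primitive_on_piece hL hg (hσ.mem_Icc _).1
    (hlt (Fin.last d)) (hσ.mem_Icc _).2 (hσ.2.2.2 (Fin.last d))
  have hpos := hlt 0
  have hltL := hlt (Fin.last d)
  rw [Fin.castSucc_zero, hσ.2.1] at hh hf hpos
  rw [Fin.succ_last, hσ.2.2.1] at hh' hf' hl' hltL
  rw [hl']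
  exact tendsto_sum_coeff_of_primitive hL g hltL hpos hh hh' hf hf'

/-- The regular part sums absolutely. In the singular part `τ_n` cancels against `α_n = τ_n β_n` and
leaves `K p_n^m β_n`, the coefficients of `K ∂^m β`, whose symmetric sums tend to the boundary term.
-/
theorem tendsto_pairing {L : ℝ} (hL : 0 < L) {m : ℕ} {φ : L2 L} {d : ℕ} {σ : Fin (d + 2) → ℝ}
    {lam r : ℝ} (hr : 0 < r) (hτ : ∀ n, r ≤ ‖tau m φ d σ n‖)
    (hconj : ∀ n, conj (tau m φ d σ (-n)) = tau m φ d σ n) (α : HPer L m)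
    (hs : Summable fun n : ℤ => coeff α.toL2 n * conj (regularPart m lam φ d σ n))
    (hα : MemTauRange m φ d σ α.toL2) :
    Tendsto (fun N : ℕ => ∑ n ∈ Finset.Icc (-(N : ℤ)) N, coeff α.toL2 n * conj (F lam φ n)) atTop
      (𝓝 (pairing m lam φ d σ α.toL2)) := by
  have hβ : MemPiecewiseSobolev (m + 1) (tauInv m φ d σ α.toL2) ∧
      IsTauImage m φ d σ (tauInv m φ d σ α.toL2) α.toL2 := by
    rw [tauInv, dif_pos hα]
    exact hα.choose_spec
  set β := tauInv m φ d σ α.toL2 with hβdef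
  obtain ⟨g, hg⟩ := exists_periodic_deriv hL
    (mem_sobolevPer_of_isTauImage hr hτ α.toL2_mem hβ.2)
  have h1 := (tendsto_sum_Icc_neg hs.hasSum).add
    ((tendsto_sum_coeff_deriv hL hg hβ.1).const_mul (K L lam : ℂ))
  have h2 : (∑' n : ℤ, coeff α.toL2 n * conj (regularPart m lam φ d σ n)) +
      (K L lam : ℂ) * (Real.sqrt L * (rightValue m β 0 + leftValue m β L) / 2)
      = pairing m lam φ d σ α.toL2 := by
    rw [pairing, ← hβdef]
    push_cast
    ring
  rw [h2] at h1
  refine h1.congr fun N => ?_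
  rw [Finset.mul_sum, ← Finset.sum_add_distrib]
  refine Finset.sum_congr rfl fun n _ => ?_
  have hτn : tau m φ d σ n ≠ 0 := norm_pos_iff.1 (hr.trans_le (hτ n))
  have h3 : conj (singularPart m lam φ d σ n) = K L lam * freq L n ^ m / tau m φ d σ n := by
    rw [singularPart, map_mul, map_mul, map_pow, map_pow, map_div₀, hconj, conj_freq,
      Complex.conj_ofReal, map_neg, map_one, neg_pow (freq L n)]
    rw [show (-1 : ℂ) ^ m * (K L lam / tau m φ d σ n) * ((-1) ^ m * freq L n ^ m)
      = ((-1) ^ m * (-1) ^ m) * (K L lam * freq L n ^ m / tau m φ d σ n) by ring, ← mul_pow]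
    simp
  have h4 : conj (F lam φ n) = conj (regularPart m lam φ d σ n)
      + conj (singularPart m lam φ d σ n) := by
    rw [← map_add, regularPart, Pi.sub_apply, sub_add_cancel]
  rw [h4, h3, mul_add, hg, hβ.2 n]
  field_simp

/-- The terms are `K` times coefficients of `Λ^λ_p`, so the limit is `K √L / 2` times the sum of its
end values; `K` is normalised to make this `1`. -/
theorem tendsto_sum_inv_lam {L lam : ℝ} (hL : 0 < L) (hlam : 0 < lam) (p : ℤ) :
    Tendsto (fun N : ℕ => ∑ n ∈ Finset.Icc (-(N : ℤ)) N,
      (K L lam : ℂ) * (1 / ((lam : ℂ) + freq L (p - n)))) atTop (𝓝 1) := by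
  set z : ℂ := (lam : ℂ) + freq L p with hz
  set S : ℂ := ((Real.sqrt L / (1 - Real.exp (-(lam * L))) : ℝ) : ℂ) with hS
  have hd : ∀ x : ℝ, HasDerivAt (fun x : ℝ => S * Complex.exp (-(z * x)))
      (S * (Complex.exp (-(z * x)) * -z)) x := by
    intro x
    have h0 : HasDerivAt (fun y : ℝ => z * (y : ℂ)) z x := by
      simpa using (hasDerivAt_id x).ofReal_comp.const_mul z
    have h1 : HasDerivAt (fun y : ℝ => -(z * (y : ℂ))) (-z) x := h0.neg
    exact h1.cexp.const_mul S
  have hcd : Continuous fun x : ℝ => S * (Complex.exp (-(z * x)) * -z) := by fun_prop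
  have hint : ∀ x : ℝ, S + ∫ t in (0 : ℝ)..x, S * (Complex.exp (-(z * t)) * -z)
      = S * Complex.exp (-(z * x)) := by
    intro x
    rw [intervalIntegral.integral_eq_sub_of_hasDerivAt (fun t _ => hd t)
      (hcd.intervalIntegrable _ _)]
    simp
  have hmem : MemLp (fun x : ℝ => S * (Complex.exp (-(z * x)) * -z)) 2
      (volume.restrict (Ioo 0 L)) :=
    (memLp_of_continuous L _ hcd).mono_measure (Measure.restrict_mono Ioo_subset_Ioc_self le_rfl)
  have hf : ∀ᵐ x ∂(volume.restrict (Ioo 0 L)), Lam L lam p x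
      = S + ∫ t in (0 : ℝ)..x, S * (Complex.exp (-(z * t)) * -z) := by
    have h1 := ae_restrict_of_ae_restrict_of_subset Ioo_subset_Ioc_self
      (coeFn_ofContinuous L (fun x : ℝ => S * Complex.exp (-(z * x))) (by fun_prop))
    filter_upwards [h1] with x hx
    rw [hint, ← hx]
    rfl
  have h1 := (tendsto_sum_coeff_of_primitive hL (Lam L lam p) hL hL hmem hmem hf hf).const_mul
    (K L lam : ℂ)
  have hE : Complex.exp (-(z * L)) = (Real.exp (-(lam * L)) : ℂ) := by
    rw [hz, add_mul, neg_add, Complex.exp_add, Complex.exp_neg (freq L p * L),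
      exp_freq_mul_period hL]
    simp
  have hlim : (K L lam : ℂ) * (Real.sqrt L * (S + S * Complex.exp (-(z * L))) / 2) = 1 := by
    rw [hE, hS]
    norm_cast
    have h2 := one_sub_exp_pos hL hlam
    have h3 : 0 < 1 + Real.exp (-(lam * L)) := by positivity
    have h4 : Real.sqrt L * Real.sqrt L = L := Real.mul_self_sqrt hL.le
    rw [K]
    calc _ = (Real.sqrt L * Real.sqrt L) / L *
          ((1 - Real.exp (-(lam * L))) / (1 - Real.exp (-(lam * L)))) *
          ((1 + Real.exp (-(lam * L))) / (1 + Real.exp (-(lam * L)))) := by ring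
      _ = 1 := by rw [h4, div_self hL.ne', div_self h2.ne', div_self h3.ne']; ring
  rw [hint, hlim] at h1
  refine h1.congr fun N => ?_
  rw [Finset.mul_sum, ← sum_Icc_neg_comp_neg]
  refine Finset.sum_congr rfl fun n _ => ?_
  rw [coeff_Lam hL hlam, sub_eq_add_neg]

/-! ### Density of the domain -/

theorem coeff_sum {L : ℝ} {ι : Type*} (s : Finset ι) (f : ι → L2 L) (n : ℤ) :
    coeff (∑ i ∈ s, f i) n = ∑ i ∈ s, coeff (f i) n :=
  inner_sum _ _ _

theorem coeff_sum_smul_eL2 {L : ℝ} (hL : 0 < L) (s : Finset ℤ) (a : ℤ → ℂ) (n : ℤ) :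
    coeff (∑ k ∈ s, a k • eL2 L k) n = if n ∈ s then a n else 0 := by
  rw [coeff_sum]
  simp only [coeff_smul, coeff_eL2 hL, mul_ite, mul_one, mul_zero]
  exact Finset.sum_ite_eq s n a

theorem mem_sobolevPer_of_finite {L : ℝ} (k : ℕ) {f : L2 L} {s : Finset ℤ}
    (h : ∀ n ∉ s, coeff f n = 0) : f ∈ sobolevPer L k :=
  mem_sobolevPer_iff.2 (summable_of_ne_finset_zero (s := s) fun n hn => by simp [h n hn])

theorem memSobolev_of_finite {L : ℝ} (hL : 0 < L) (m : ℕ) {f : L2 L} {s : Finset ℤ}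
    (h : ∀ n ∉ s, coeff f n = 0) : MemSobolev 0 L m f := by
  intro k _
  obtain ⟨g, hg⟩ := exists_periodic_deriv hL (mem_sobolevPer_of_finite k h)
  exact ⟨g, (Lp.memLp g).mono_measure (Measure.restrict_mono Ioo_subset_Ioc_self le_rfl),
    hasWeakDeriv_of_coeff hL hg⟩

theorem memPiecewiseSobolev_of_finite {L : ℝ} (hL : 0 < L) (m : ℕ) {f : L2 L} {s : Finset ℤ}
    (h : ∀ n ∉ s, coeff f n = 0) : MemPiecewiseSobolev m f := by
  refine ⟨0, ![0, L], ?_, rfl, rfl, fun j => ?_⟩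
  · intro i j hij
    fin_cases i <;> fin_cases j <;> simp_all
  · fin_cases j
    exact memSobolev_of_finite hL m h

/-- For a trigonometric polynomial the limit defining the pairing is the finite sum in `h0`, so the
feedback term vanishes and the closed loop is again a trigonometric polynomial. -/
theorem mem_domain_of_finite {L : ℝ} (hL : 0 < L) {m : ℕ} {φ : L2 L} {d : ℕ}
    {σ : Fin (d + 2) → ℝ} {lam r : ℝ} (μ : ℝ) (hr : 0 < r) (hτ : ∀ n, r ≤ ‖tau m φ d σ n‖)
    (hconj : ∀ n, conj (tau m φ d σ (-n)) = tau m φ d σ n) {α : HPer L m} {s : Finset ℤ}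
    (h : ∀ n ∉ s, coeff α.toL2 n = 0)
    (h0 : ∑ n ∈ s, coeff α.toL2 n * conj (F lam φ n) = 0) : α ∈ domain m lam μ φ d σ := by
  have hτ0 : ∀ n, tau m φ d σ n ≠ 0 := fun n => norm_pos_iff.1 (hr.trans_le (hτ n))
  have hrange : MemTauRange m φ d σ α.toL2 := by
    have hc := coeff_sum_smul_eL2 hL s fun n => coeff α.toL2 n / tau m φ d σ n
    refine ⟨_, memPiecewiseSobolev_of_finite hL (m + 1) (s := s)
      (f := ∑ k ∈ s, (coeff α.toL2 k / tau m φ d σ k) • eL2 L k)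
      (fun n hn => by rw [hc, if_neg hn]), fun n => ?_⟩
    rw [hc]
    split_ifs with hn
    · rw [mul_div_cancel₀ _ (hτ0 n)]
    · rw [h n hn, mul_zero]
  have hpair : pairing m lam φ d σ α.toL2 = 0 := by
    refine tendsto_nhds_unique (tendsto_pairing hL hr hτ hconj α ?_ hrange) (h0 ▸
      tendsto_sum_Icc_neg (hasSum_sum_of_ne_finset_zero fun n hn => by rw [h n hn, zero_mul]))
    exact summable_of_ne_finset_zero (s := s) fun n hn => by rw [h n hn, zero_mul]
  have hc := coeff_sum_smul_eL2 hL s fun n => -(freq L n * coeff α.toL2 n) - μ * coeff α.toL2 n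
  refine ⟨hrange, HPer.mk
    (∑ n ∈ s, (-(freq L n * coeff α.toL2 n) - μ * coeff α.toL2 n) • eL2 L n)
    (mem_sobolevPer_of_finite m (s := s) fun n hn => by rw [hc, if_neg hn]), ?_⟩
  funext n
  change coeff _ n = -(freq L n * coeff α.toL2 n) - μ * coeff α.toL2 n
    + pairing m lam φ d σ α.toL2 * coeff φ n
  rw [HPer.toL2_mk, hc, hpair, zero_mul, add_zero]
  split_ifs with hn
  · rfl
  · rw [h n hn]; ring

/-- The trigonometric polynomial with coefficients `a` on `s`, in `H^m_per`. -/
noncomputable def trigPoly {L : ℝ} (hL : 0 < L) (m : ℕ) (s : Finset ℤ) (a : ℤ → ℂ) : HPer L m :=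
  HPer.mk (∑ k ∈ s, a k • eL2 L k)
    (mem_sobolevPer_of_finite m (s := s) fun n hn => by rw [coeff_sum_smul_eL2 hL, if_neg hn])

theorem coeff_trigPoly {L : ℝ} (hL : 0 < L) (m : ℕ) (s : Finset ℤ) (a : ℤ → ℂ) (n : ℤ) :
    coeff (trigPoly hL m s a).toL2 n = if n ∈ s then a n else 0 :=
  coeff_sum_smul_eL2 hL s a n

/-- The multiplier `weight^{-1/2}` carries `L²` continuously to `H^m_per`, so the `L²` expansion of
the weighted coefficients is transported by it. -/
theorem tendsto_trigPoly {L : ℝ} (hL : 0 < L) {m : ℕ} (f : HPer L m) :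
    Tendsto (fun s : Finset ℤ => trigPoly hL m s (coeff f.toL2)) atTop (𝓝 f) := by
  have hw : ∀ n, 0 < Real.sqrt (weight L m n) := fun n => Real.sqrt_pos.2 (weight_pos L m n)
  obtain ⟨D, hD⟩ := exists_multiplier hL m (fun n => ((1 / Real.sqrt (weight L m n) : ℝ) : ℂ)) 1
    (fun n => by rw [Complex.norm_real, Real.norm_of_nonneg (one_div_pos.2 (hw n)).le])
  obtain ⟨u, hu⟩ := exists_coeff_eq hL ((memlp_weightedCoeff_iff m f.toL2).2 f.toL2_mem)
  have hcancel : ∀ n, ((1 / Real.sqrt (weight L m n) : ℝ) : ℂ) * weightedCoeff m f.toL2 n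
      = coeff f.toL2 n := by
    intro n
    rw [weightedCoeff, ← mul_assoc, ← Complex.ofReal_mul, one_div_mul_cancel (hw n).ne',
      Complex.ofReal_one, one_mul]
  have hDu : D u = f := HPer.ext_coeff fun n => by rw [hD, hu, hcancel]
  have h1 : Tendsto (fun s : Finset ℤ => ∑ n ∈ s, coeff u n • eL2 L n) atTop (𝓝 u) := by
    simpa only [HasSum, SummationFilter.unconditional_filter] using hasSum_coeff hL u
  have h2 := (D.continuous.tendsto u).comp h1
  rw [hDu] at h2
  refine h2.congr fun s => HPer.ext_coeff fun n => ?_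
  rw [Function.comp_apply, hD, coeff_sum_smul_eL2 hL, coeff_trigPoly, hu, mul_ite, mul_zero,
    hcancel]

theorem norm_sq_trigPoly {L : ℝ} (hL : 0 < L) (m : ℕ) (s : Finset ℤ) (a : ℤ → ℂ) :
    ‖trigPoly hL m s a‖ ^ 2 = ∑ n ∈ s, weight L m n * ‖a n‖ ^ 2 := by
  rw [HPer.norm_sq, tsum_eq_sum (s := s)]
  · exact Finset.sum_congr rfl fun n hn => by rw [coeff_trigPoly, if_pos hn]
  · intro n hn
    rw [coeff_trigPoly, if_neg hn]
    simp

theorem dense_domain {L : ℝ} (hL : 0 < L) {m : ℕ} {φ : L2 L} {d : ℕ}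
    {σ : Fin (d + 2) → ℝ} {lam r C : ℝ} (hlam : 0 < lam) (μ : ℝ) (hr : 0 < r)
    (hτ : ∀ n, r ≤ ‖tau m φ d σ n‖) (hconj : ∀ n, conj (tau m φ d σ (-n)) = tau m φ d σ n)
    (hφ0 : ∀ n, coeff φ n ≠ 0) (hφ : ∀ n, ‖coeff φ n‖ ≤ C / Real.sqrt (weight L m n)) :
    Dense (domain m lam μ φ d σ) := by
  rw [Metric.dense_iff]
  intro f ε hε
  have hK := K_pos (L := L) hL hlam
  have hF0 : ∀ n, conj (F lam φ n) ≠ 0 := fun n => by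
    rw [conj_F]
    exact neg_ne_zero.2 (div_ne_zero (by exact_mod_cast hK.ne') (hφ0 n))
  obtain ⟨s, hs⟩ := ((tendsto_trigPoly hL f).eventually
    (Metric.ball_mem_nhds f (half_pos hε))).exists
  set ℓ : ℂ := ∑ n ∈ s, coeff f.toL2 n * conj (F lam φ n) with hℓ
  -- The correction has squared norm at most `N (‖ℓ‖ C / (K N))²`; this `N` brings it below `(ε /
  -- 2)²`.
  obtain ⟨N, hN⟩ := exists_nat_gt ((‖ℓ‖ * C / K L lam) ^ 2 / (ε / 2) ^ 2)
  have hN0 : 0 < (N : ℝ) := lt_of_le_of_lt (by positivity) hN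
  set t : Finset ℤ := Finset.Ioc 0 (N : ℤ) with ht
  have htc : (t.card : ℂ) = N := by simp [ht]
  have htc' : (t.card : ℝ) = N := by simp [ht]
  -- Each of the `N` frequencies in `t` contributes `ℓ / N` to the pairing with `F`, so subtracting
  -- the correction cancels `ℓ` exactly.
  set b : ℤ → ℂ := fun n => ℓ / N / conj (F lam φ n) with hb
  have hnorm : ‖trigPoly hL m t b‖ < ε / 2 := by
    rw [← sq_lt_sq₀ (norm_nonneg _) (half_pos hε).le, norm_sq_trigPoly]
    have h1 : ∀ n ∈ t, weight L m n * ‖b n‖ ^ 2 ≤ (‖ℓ‖ * C / K L lam) ^ 2 / N ^ 2 := by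
      intro n _
      have h2 : ‖b n‖ = ‖ℓ‖ / N / K L lam * ‖coeff φ n‖ := by
        rw [hb]
        simp only
        rw [conj_F, norm_div, norm_neg, norm_div, norm_div, Complex.norm_natCast,
          Complex.norm_real, Real.norm_of_nonneg hK.le, div_div_eq_mul_div]
        ring
      have hwp := Real.sqrt_pos.2 (weight_pos L m n)
      have h3 : Real.sqrt (weight L m n) * ‖b n‖ ≤ ‖ℓ‖ * C / K L lam / N := by
        rw [h2]
        calc _ ≤ Real.sqrt (weight L m n) *
              (‖ℓ‖ / N / K L lam * (C / Real.sqrt (weight L m n))) := by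
              have := hφ n
              gcongr
          _ = _ := by field_simp
      have h4 := pow_le_pow_left₀ (by positivity) h3 2
      rwa [mul_pow, Real.sq_sqrt (weight_pos L m n).le, div_pow _ (N : ℝ)] at h4
    refine (Finset.sum_le_sum h1).trans_lt ?_
    rw [Finset.sum_const, nsmul_eq_mul, htc']
    rw [div_lt_iff₀ (by positivity)] at hN
    have h5 : (N : ℝ) * ((‖ℓ‖ * C / K L lam) ^ 2 / N ^ 2) = (‖ℓ‖ * C / K L lam) ^ 2 / N := by
      field_simp
    rw [h5, div_lt_iff₀ hN0]
    linarith
  refine ⟨trigPoly hL m s (coeff f.toL2) - trigPoly hL m t b, ?_, ?_⟩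
  · rw [dist_eq_norm] at hs
    rw [mem_ball_iff_norm]
    calc _ = ‖(trigPoly hL m s (coeff f.toL2) - f) - trigPoly hL m t b‖ := by congr 1; abel
      _ ≤ _ := norm_sub_le _ _
      _ < ε / 2 + ε / 2 := add_lt_add hs hnorm
      _ = ε := add_halves ε
  · have hc : ∀ n, coeff (trigPoly hL m s (coeff f.toL2) - trigPoly hL m t b).toL2 n
        = (if n ∈ s then coeff f.toL2 n else 0) - if n ∈ t then b n else 0 := by
      intro n
      rw [map_sub, sub_eq_add_neg, ← neg_one_smul ℂ, coeff_add, coeff_smul, coeff_trigPoly,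
        coeff_trigPoly]
      ring
    refine mem_domain_of_finite hL μ hr hτ hconj (s := s ∪ t) (fun n hn => ?_) ?_
    · rw [Finset.mem_union, not_or] at hn
      rw [hc, if_neg hn.1, if_neg hn.2, sub_zero]
    · simp_rw [hc, sub_mul, ite_mul, zero_mul]
      rw [Finset.sum_sub_distrib, Finset.sum_ite_mem, Finset.sum_ite_mem,
        Finset.union_inter_cancel_left, Finset.union_inter_cancel_right, ← hℓ]
      have h6 : ∀ n ∈ t, b n * conj (F lam φ n) = ℓ / N := fun n _ => by
        rw [hb]; exact div_mul_cancel₀ _ (hF0 n)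
      have hNc : (N : ℂ) ≠ 0 := by exact_mod_cast hN0.ne'
      rw [Finset.sum_congr rfl h6, Finset.sum_const, nsmul_eq_mul, htc, mul_div_cancel₀ _ hNc,
        sub_self]

/-! ### The operator equality -/

/-- Both `T`-series converge unconditionally, so symmetric summation is allowed and matches the
sense in which the pairing and the sum of `K / (λ + p_{p-n})` converge. The two terms carrying the
pairing then cancel in the limit. -/
theorem coeff_T_closedLoop {L lam lam' μ : ℝ} (hL : 0 < L) (hlam : 0 < lam) (hμ : lam = lam' - μ)
    {m : ℕ} {φ : L2 L} {c C : ℝ} (hc : 0 < c)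
    (hφ1 : ∀ n, c / Real.sqrt (weight L m n) ≤ ‖coeff φ n‖)
    (hφ2 : ∀ n, ‖coeff φ n‖ ≤ C / Real.sqrt (weight L m n)) (hφ0 : ∀ n, coeff φ n ≠ 0)
    {d : ℕ} {σ : Fin (d + 2) → ℝ} {α g : HPer L m}
    (hα : Tendsto (fun N : ℕ => ∑ n ∈ Finset.Icc (-(N : ℤ)) N,
      coeff α.toL2 n * conj (F lam φ n)) atTop (𝓝 (pairing m lam φ d σ α.toL2)))
    (hg : g.toDual = closedLoop m lam μ φ d σ α) (p : ℤ) :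
    coeff (T m lam φ g).toL2 p
      = -(freq L p * coeff (T m lam φ α).toL2 p) - lam' * coeff (T m lam φ α).toL2 p := by
  set P := pairing m lam φ d σ α.toL2 with hP
  have hgn : ∀ n, coeff g.toL2 n
      = -(freq L n * coeff α.toL2 n) - μ * coeff α.toL2 n + P * coeff φ n :=
    fun n => congrFun hg n
  have h1 := tendsto_sum_Icc_neg (hasSum_coeff_T (lam := lam) hL hlam hc hφ1 hφ2 g p)
  have h2 := tendsto_sum_Icc_neg (hasSum_coeff_T (lam := lam) hL hlam hc hφ1 hφ2 α p)
  have h3 := ((h2.const_mul (-(freq L p + lam'))).sub (hα.const_mul (coeff φ p))).add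
    ((tendsto_sum_inv_lam hL hlam p).const_mul (P * coeff φ p))
  have h4 : -(freq L p + lam') * coeff (T m lam φ α).toL2 p - coeff φ p * P + P * coeff φ p * 1
      = -(freq L p * coeff (T m lam φ α).toL2 p) - lam' * coeff (T m lam φ α).toL2 p := by ring
  rw [h4] at h3
  refine tendsto_nhds_unique h1 (h3.congr fun N => ?_)
  rw [Finset.mul_sum, Finset.mul_sum, Finset.mul_sum, ← Finset.sum_sub_distrib,
    ← Finset.sum_add_distrib]
  refine Finset.sum_congr rfl fun n _ => ?_
  have hD := lam_add_freq_ne_zero hlam L (p - n)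
  have hφn := hφ0 n
  -- With this, `λ + p_p - p_n` equals `(p_p + λ') - (p_n + μ)` and the denominators clear term by
  -- term.
  have hlam' : (lam' : ℂ) = lam + μ := by rw [hμ]; push_cast; ring
  rw [freq_sub] at hD
  rw [hgn, conj_F, freq_sub, hlam']
  field_simp
  ring

end Backstepping

theorem mainTheorem4
    (L : ℝ) (hL : 0 < L) (m : ℕ) (hm : 1 ≤ m)
    (φ : Backstepping.L2 L)
    (hφ_real : ∀ᵐ x ∂(Backstepping.vol L), (φ x).im = 0)
    (hφ_per : φ ∈ Backstepping.sobolevPer L (m - 1))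
    (d : ℕ) (σ : Fin (d + 2) → ℝ)
    (hφ_pw : Backstepping.IsPiecewiseSobolev m φ d σ)
    (c C : ℝ) (hc : 0 < c) (hC : 0 < C)
    (hφ_growth : ∀ n : ℤ,
      c / Real.sqrt (Backstepping.weight L m n) ≤ ‖Backstepping.coeff φ n‖ ∧
      ‖Backstepping.coeff φ n‖ ≤ C / Real.sqrt (Backstepping.weight L m n))
    (μ lam' lam : ℝ) (hlam : lam = lam' - μ) (hlam_pos : 0 < lam) :
    -- the transformation and the feedback are well defined on `H^m_per` and on the domain
    (∀ n : ℤ, Backstepping.kernel lam φ n ∈ Backstepping.sobolevPer L m) ∧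
    (∀ α : Backstepping.HPer L m, Summable fun n : ℤ =>
      Backstepping.coeff α.toL2 n • Backstepping.toHPer m (Backstepping.kernel lam φ (-n))) ∧
    (∀ α : Backstepping.HPer L m, Summable fun n : ℤ =>
      Backstepping.coeff α.toL2 n * (starRingEnd ℂ) (Backstepping.regularPart m lam φ d σ n)) ∧
    -- the domain is dense
    Dense (Backstepping.domain m lam μ φ d σ) ∧
    -- the operator equality, in `H^m_per`
    ∀ α ∈ Backstepping.domain m lam μ φ d σ, ∃ g w : Backstepping.HPer L m,
      g.toDual = Backstepping.closedLoop m lam μ φ d σ α ∧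
      w.toDual = -Backstepping.derivDual L (Backstepping.T m lam φ α).toDual
        - (lam' : ℂ) • (Backstepping.T m lam φ α).toDual ∧
      Backstepping.T m lam φ g = w := by
  have hφ1 := fun n => (hφ_growth n).1
  have hφ2 := fun n => (hφ_growth n).2
  have hφ0 : ∀ n, Backstepping.coeff φ n ≠ 0 := fun n => norm_pos_iff.1
    ((div_pos hc (Real.sqrt_pos.2 (Backstepping.weight_pos L m n))).trans_le (hφ1 n))
  obtain ⟨ψ, hψ, hψτ⟩ : ∃ ψ : ℤ → ℂ, Memℓp ψ 2 ∧ ∀ n, Backstepping.freq L n ^ m *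
      Backstepping.coeff φ n = -Backstepping.tau m φ d σ n + ψ n := by
    obtain ⟨k, rfl⟩ : ∃ k, m = k + 1 := ⟨m - 1, by omega⟩
    exact Backstepping.exists_coeff_eq_neg_tau_add hL hφ_per hφ_pw
  have hr : 0 < c / 4 := by positivity
  have hτ := Backstepping.tau_bounded_below hL hc hφ1 hψ hψτ
  have hconj := Backstepping.conj_tau hL hφ_real hψ hψτ
  have hreg := Backstepping.regularPart_eq hφ_real hφ0
    (fun n => norm_pos_iff.1 (hr.trans_le (hτ n))) hψτ lam
  have hsum := Backstepping.summable_regularPart hc hφ1 hr hτ hψ hreg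
  refine ⟨Backstepping.kernel_mem hL lam hφ2,
    fun α => (Backstepping.hasSum_T hL hc hφ1 hφ2 α).summable, hsum,
    Backstepping.dense_domain hL hlam_pos μ hr hτ hconj hφ0 hφ2, fun α hα => ?_⟩
  obtain ⟨hrange, g, hg⟩ := hα
  -- Taking `T g` itself as `w` makes the membership of the right-hand side in `H^m_per` automatic;
  -- only the coefficient identity remains.
  refine ⟨g, Backstepping.T m lam φ g, hg, ?_, rfl⟩
  funext p
  exact Backstepping.coeff_T_closedLoop hL hlam_pos hlam hc hφ1 hφ2 hφ0
    (Backstepping.tendsto_pairing hL hr hτ hconj α (hsum α) hrange) hg p
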